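/- **Setting.** For $f:\mathbb R^2\to\mathbb C$ let $\widehat f(k)=\int_{\mathbb R^2}f(x)e^{-ik\cdot x}\,dx$, and let $e^{it\Delta}$ be the Fourier multiplier $e^{-it|k|^2}$. Let $\eta:\mathbb R^2\to\mathbb C$ be smooth with compact support, and for $L,h,\sigma>0$ put $\mathbb Z_L^2=\{(n_1/L,n_2/L):n_1,n_2\in\mathbb Z\}$, $\eta_K=\eta(K)$, $$\varphi(x)=\frac1{(2\pi)^2}e^{-\frac12h^2|x|^2}\sum_{K\in\mathbb Z_L^2}\eta_Ke^{iK\cdot x},\qquad V^1(t)=\int_0^te^{-is\Delta}\big(|e^{is\Delta}\varphi|^2e^{is\Delta}\varphi\big)\,ds ,$$ $$\langle v\rangle_{K,\sigma}=\int_{\mathbb R^2}e^{-\frac{1}{2\sigma^2}|k-K|^2}\,\widehat v(k)\,dk ,\qquad \Delta\omega_{k\ell mj}=|k|^2+|m|^2-|\ell|^2-|j|^2 .$$ ($V^1$ is the first-order term in the expansion of $e^{-it\Delta}u(t)$ where $i\partial_tu=-\Delta u+|u|^2u$, $u(0)=\varphi$.) A family of positive parameters $(h,L,\sigma)$ is in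 the asymptotic regime (AR) if $L\to\infty$, $hL^{4+\delta_0}\le1$ for some fixed $\delta_0>0$, and $hL\ll\sigma\le h^{3/4}$. **Proposition.** For $K\in\mathbb Z_L^2$ and $t\ge0$ write $$\langle V^1(t)\rangle_{K,\sigma}=\frac1{(2\pi)^4}\sum_{K=K_1-K_2+K_3}\eta_{K_1}\overline{\eta_{K_2}}\eta_{K_3}\,\frac{1-e^{-it\Delta\omega_{K_1K_2K_3K}}}{i\Delta\omega_{K_1K_2K_3K}}+r_K(t,\eta),$$ the sum being over $K_1,K_2,K_3\in\mathbb Z_L^2$, with the convention $\frac{1-e^{-it0}}{i0}=t$. Note that $\Delta\omega_{K_1K_2K_3K}=|K_1|^2-|K_2|^2+|K_3|^2-|K|^2$. 1. There is a constant $C>0$ depending only on $\eta$, and for every $\delta>0$ a constant $C_\delta>0$ depending only on $\eta$ and $\delta$, such that in every family in the regime (AR) one has eventually (for $L$ large enough and $hL/\sigma$ small enough), for all $K\in\mathbb Z_L^2$ and all $0\le t\le\frac1{\sigma^2L^2}$, $$\begin{aligned}|r_K(t,\eta)|\le{}&CL^6e^{-\frac1{2\sigma^2L^2}+C\left(t+\frac{h^2}{\sigma^4}\right)}+CtL^2\log(L)\Big(\frac{h^2}{\sigma^2}+t\sigma^2+t^2h^2+t^3\sigma^4\Big)\\&+C_\delta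 L^{4+\delta}\Big(\frac{h^2}{\sigma^2}+t\sigma^2+t^2\sigma^2+t^3\sigma^4\Big).\end{aligned}$$ 2. In the regime (AR), for $K\in\mathbb Z_L^2$ and $t\ge0$ possibly varying with the parameters, $$t\ll\frac1h\quad\Longrightarrow\quad|r_K(t,\eta)|\ll tL^2\log(L)+L^4 .$$ -/

import Mathlib

open Filter Topology MeasureTheory Asymptotics

namespace CoarseNLS

noncomputable section

/-- The Euclidean plane. -/
abbrev Plane : Type := EuclideanSpace ℝ (Fin 2)

/-- The Fourier transform, `f̂(k) = ∫ f(x) e^{-i k·x} dx`. -/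
def fourier (f : Plane → ℂ) (k : Plane) : ℂ :=
  ∫ x : Plane, f x * Complex.exp (-(Complex.I * ((inner ℝ k x : ℝ) : ℂ)))

/-- The inverse Fourier transform, `(2π)⁻² ∫ f(k) e^{i k·x} dk`. -/
def invFourier (f : Plane → ℂ) (x : Plane) : ℂ :=
  (1 / (2 * (Real.pi : ℂ)) ^ 2) *
    ∫ k : Plane, f k * Complex.exp (Complex.I * ((inner ℝ k x : ℝ) : ℂ))

/-- The free Schrödinger propagator `e^{itΔ}`, the Fourier multiplier `e^{-it|k|²}`. -/
def propagator (t : ℝ) (f : Plane → ℂ) : Plane → ℂ :=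
  invFourier fun k => Complex.exp (-(Complex.I * (t : ℂ) * (((‖k‖ ^ 2 : ℝ)) : ℂ))) * fourier f k

/-- The lattice `ℤ_L²` of mesh `1 / L`, as a set of points of the plane. -/
def lattice (L : ℝ) : Set Plane :=
  {K | ∃ n : Fin 2 → ℤ, ∀ j, K j = (n j : ℝ) / L}

/-- The Gaussian wave packet `g_{K,ε}(x) = (2π)⁻² e^{i K·x} e^{-ε²|x|²/2}`. -/
def gauss (K : Plane) (ε : ℝ) (x : Plane) : ℂ :=
  (1 / (2 * (Real.pi : ℂ)) ^ 2) * Complex.exp (Complex.I * ((inner ℝ K x : ℝ) : ℂ)) *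
    ((Real.exp (-(1 / 2) * ε ^ 2 * ‖x‖ ^ 2) : ℝ) : ℂ)

/-- The initial datum `φ = ∑_{K ∈ ℤ_L²} η(K) g_{K,h}`. The sum has finitely many nonzero terms
when `η` has compact support and `L > 0`. -/
def initialDatum (η : Plane → ℂ) (h L : ℝ) (x : Plane) : ℂ :=
  ∑' K : lattice L, η K * gauss K h x

/-- The first order (cubic) term in the expansion of `v(t) = e^{-itΔ} u(t)`, where `u` solves
`i ∂ₜ u = -Δ u + |u|² u` with `u(0) = φ`:
`V¹(t) = ∫₀ᵗ e^{-isΔ} ( |e^{isΔ} φ|² e^{isΔ} φ ) ds`. -/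
def firstOrder (φ : Plane → ℂ) (t : ℝ) (x : Plane) : ℂ :=
  ∫ s in (0 : ℝ)..t,
    propagator (-s)
      (fun y => ((‖propagator s φ y‖ ^ 2 : ℝ) : ℂ) * propagator s φ y) x

/-- The coarse grained quantity `⟨v⟩_{K,σ} = ∫ e^{-|k-K|²/(2σ²)} v̂(k) dk`. -/
def coarse (v : Plane → ℂ) (K : Plane) (σ : ℝ) : ℂ :=
  ∫ k : Plane, ((Real.exp (-(1 / (2 * σ ^ 2)) * ‖k - K‖ ^ 2) : ℝ) : ℂ) * fourier v k

/-- `Δω_{kℓmj} = |k|² + |m|² - |ℓ|² - |j|²`. -/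
def resonance (k l m j : Plane) : ℝ :=
  ‖k‖ ^ 2 + ‖m‖ ^ 2 - ‖l‖ ^ 2 - ‖j‖ ^ 2

/-- `(1 - e^{-itω}) / (iω)`, with the convention that the value at `ω = 0` is `t`. -/
def oscillation (t ω : ℝ) : ℂ :=
  if ω = 0 then (t : ℂ)
  else (1 - Complex.exp (-(Complex.I * (t : ℂ) * (ω : ℂ)))) / (Complex.I * (ω : ℂ))

/-- The triples `(K₁, K₂, K₃)` of lattice points with `K = K₁ - K₂ + K₃`. -/
def interactions (L : ℝ) (K : Plane) : Set (Plane × Plane × Plane) :=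
  {p | p.1 ∈ lattice L ∧ p.2.1 ∈ lattice L ∧ p.2.2 ∈ lattice L ∧ K = p.1 - p.2.1 + p.2.2}

/-- The sum over `K = K₁ - K₂ + K₃` of `η(K₁) conj(η(K₂)) η(K₃) (1 - e^{-itΔω}) / (iΔω)`, with
`Δω = Δω_{K₁K₂K₃K} = |K₁|² - |K₂|² + |K₃|² - |K|²`. -/
def interactionSum (η : Plane → ℂ) (L : ℝ) (K : Plane) (t : ℝ) : ℂ :=
  ∑' p : interactions L K,
    η p.1.1 * (starRingEnd ℂ) (η p.1.2.1) * η p.1.2.2 *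
      oscillation t (resonance p.1.1 p.1.2.1 p.1.2.2 K)

/-- The asymptotic regime (AR) for a family of parameters `(h, L, σ)` along a filter:
`L ≫ 1`, `h L^{4+δ₀} ≤ 1` for some `δ₀ > 0`, and `h L ≪ σ ≤ h^{3/4}`. -/
structure AsymptoticRegime {ι : Type*} (l : Filter ι) (h L σ : ι → ℝ) : Prop where
  pos : ∀ᶠ i in l, 0 < h i ∧ 0 < L i ∧ 0 < σ i
  large : Tendsto L l atTop
  truncation : ∃ δ₀ : ℝ, 0 < δ₀ ∧ ∀ᶠ i in l, h i * L i ^ (4 + δ₀) ≤ 1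
  lower : (fun i => h i * L i) =o[l] σ
  upper : ∀ᶠ i in l, σ i ≤ h i ^ (3 / 4 : ℝ)

end

end CoarseNLS

/-!
Everything is Gaussian: the contribution to `⟨V¹(t)⟩_{K,σ}` of three wave packets is `∫₀ᵗ` of an
explicit exponential. If `K₁ - K₂ + K₃ ≠ K`, these two lattice points are at distance at least
`1 / L` and the exponential is at most `exp (-1 / (2σ²L²))` up to harmless factors. If
`K₁ - K₂ + K₃ = K`, the integrand is `e^{-isΔω}` times `1` plus a slowly varying error of size
`O(h²/σ² + s h² + s² h²)`. When `Δω ≠ 0` an integration by parts gains `1 / |Δω|`, and when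
`Δω = 0` the error is multiplied by `t`. A resonant triple is a parallelogram with vertex `K` whose
sides `n / L`, `m / L` satisfy `Δω = ± 2 n·m / L²`, so what remains is to count orthogonal pairs of
integer vectors, which gives `L² log L`, and to sum `1 / |n·m|`, which is controlled by the
multiplicative energy of an interval and gives `L² log² L`, hence `L⁴ log² L` after scaling.
-/

namespace CoarseNLS

noncomputable section

open Complex (I)
open scoped Real

/-! ### Gaussians on the plane -/

/-- The complex Gaussian `exp (-A |x|² + w · x)` of complex inverse square width `A` and complex
frequency `w`. All functions of the plane met below are finite combinations of these. -/
def gexp (A : ℂ) (w : Fin 2 → ℂ) (x : Plane) : ℂ :=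
  Complex.exp (-A * ∑ j, (x j : ℂ) ^ 2 + ∑ j, w j * x j)

lemma continuous_gexp_comp {X : Type*} [TopologicalSpace X] {A : X → ℂ} {w : X → Fin 2 → ℂ}
    {x : X → Plane} (hA : Continuous A) (hw : Continuous w) (hx : Continuous x) :
    Continuous fun y => gexp (A y) (w y) (x y) := by
  unfold gexp
  fun_prop

lemma integrable_gexp {A : ℂ} (hA : 0 < A.re) (w : Fin 2 → ℂ) : Integrable (gexp A w) := by
  have h := GaussianFourier.integrable_cexp_neg_mul_sum_add hA w
  rwa [← (PiLp.volume_preserving_ofLp (Fin 2)).integrable_comp_emb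
    (MeasurableEquiv.toLp 2 (Fin 2 → ℝ)).symm.measurableEmbedding] at h

lemma integral_gexp {A : ℂ} (hA : 0 < A.re) (w : Fin 2 → ℂ) :
    ∫ x, gexp A w x = π / A * Complex.exp ((∑ j, w j ^ 2) / (4 * A)) := by
  have h := GaussianFourier.integral_cexp_neg_mul_sum_add hA w
  rw [← (PiLp.volume_preserving_ofLp (Fin 2)).integral_comp
    (MeasurableEquiv.toLp 2 (Fin 2 → ℝ)).symm.measurableEmbedding] at h
  simpa [gexp] using h

lemma gexp_mul_gexp (A A' : ℂ) (w w' : Fin 2 → ℂ) (x : Plane) :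
    gexp A w x * gexp A' w' x = gexp (A + A') (w + w') x := by
  simp only [gexp, ← Complex.exp_add, Pi.add_apply, add_mul, Finset.sum_add_distrib]
  ring_nf

lemma conj_gexp (A : ℂ) (w : Fin 2 → ℂ) (x : Plane) :
    (starRingEnd ℂ) (gexp A w x) =
      gexp ((starRingEnd ℂ) A) (fun j => (starRingEnd ℂ) (w j)) x := by
  simp [gexp, ← Complex.exp_conj]

lemma inner_eq_sum (k x : Plane) : inner ℝ k x = ∑ j, k j * x j := by
  simp [PiLp.inner_apply, mul_comm]

lemma norm_sq_eq_sum (x : Plane) : ‖x‖ ^ 2 = ∑ j, x j ^ 2 := by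
  simp [EuclideanSpace.norm_sq_eq]

lemma exp_neg_I_mul_inner_eq_gexp (k x : Plane) :
    Complex.exp (-(I * ((inner ℝ k x : ℝ) : ℂ))) = gexp 0 (fun j => -I * k j) x := by
  simp only [gexp, inner_eq_sum, Fin.sum_univ_two]
  push_cast
  ring_nf

lemma norm_exp_neg_I_mul_inner (k x : Plane) :
    ‖Complex.exp (-(I * ((inner ℝ k x : ℝ) : ℂ)))‖ = 1 := by
  simp [Complex.norm_exp]

lemma ne_zero_of_re_pos {A : ℂ} (hA : 0 < A.re) : A ≠ 0 := by
  rintro rfl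
  exact hA.ne' Complex.zero_re

lemma inv_re_pos {A : ℂ} (hA : 0 < A.re) : 0 < A⁻¹.re := by
  rw [Complex.inv_re]
  exact div_pos hA (Complex.normSq_pos.2 (ne_zero_of_re_pos hA))

lemma inv_four_mul_re_pos {A : ℂ} (hA : 0 < A.re) : 0 < (4 * A)⁻¹.re :=
  inv_re_pos (by simpa using hA)

lemma norm_gexp_le {A : ℂ} {w : Fin 2 → ℂ} {m B : ℝ} (hm : 0 < m) (hA : 2 * m ≤ A.re)
    (hw : ‖w‖ ≤ B) (x : Plane) :
    ‖gexp A w x‖ ≤ Real.exp (B ^ 2 / (2 * m)) * ‖gexp m 0 x‖ := by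
  have hre (A : ℂ) (w : Fin 2 → ℂ) : (-A * ∑ j, (x j : ℂ) ^ 2 + ∑ j, w j * x j).re =
      ∑ j, (-A.re * x j ^ 2 + (w j).re * x j) := by
    simp only [Fin.sum_univ_two, ← Complex.ofReal_pow, ← Complex.ofReal_add,
      Complex.add_re, Complex.re_mul_ofReal, Complex.neg_re]
    ring
  have hyoung (j : Fin 2) : (w j).re * x j ≤ m * x j ^ 2 + B ^ 2 / (4 * m) := by
    have hwj : |(w j).re| ≤ B := (Complex.abs_re_le_norm _).trans ((norm_le_pi_norm w j).trans hw)
    have hsq : (w j).re ^ 2 ≤ B ^ 2 := sq_le_sq' (neg_le_of_abs_le hwj) (le_of_abs_le hwj)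
    rw [← sub_le_iff_le_add', le_div_iff₀ (by positivity)]
    nlinarith [sq_nonneg (2 * m * x j - (w j).re)]
  rw [gexp, gexp, Complex.norm_exp, Complex.norm_exp, hre, hre, ← Real.exp_add]
  refine Real.exp_le_exp.2 ?_
  have hcoord (j : Fin 2) :
      -A.re * x j ^ 2 + (w j).re * x j ≤ B ^ 2 / (4 * m) + -m * x j ^ 2 := by
    nlinarith [hyoung j, sq_nonneg (x j)]
  calc ∑ j, (-A.re * x j ^ 2 + (w j).re * x j)
      ≤ ∑ j, (B ^ 2 / (4 * m) + -m * x j ^ 2) := Finset.sum_le_sum fun j _ => hcoord j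
    _ = _ := by
        simp only [Fin.sum_univ_two, Complex.ofReal_re, Pi.zero_apply, Complex.zero_re, zero_mul]
        field_simp
        ring

/-! ### Fourier transform, free flow and coarse graining of Gaussians -/

section Linearity

variable {ι : Type*} {S : Finset ι} {f : ι → Plane → ℂ}

lemma integrable_mul_exp_neg_I_mul_inner {v : Plane → ℂ} (hv : Integrable v) (k : Plane) :
    Integrable fun x => v x * Complex.exp (-(I * ((inner ℝ k x : ℝ) : ℂ))) :=
  hv.mul_bdd (c := 1) (Continuous.aestronglyMeasurable (by fun_prop))
    (Eventually.of_forall fun x => (norm_exp_neg_I_mul_inner k x).le)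

lemma fourier_const_mul (c : ℂ) (f : Plane → ℂ) (k : Plane) :
    fourier (fun x => c * f x) k = c * fourier f k := by
  simp only [fourier, mul_assoc, integral_const_mul]

lemma integrable_fourier_const_mul {v : Plane → ℂ} (hv : Integrable (fourier v)) (c : ℂ) :
    Integrable (fourier fun x => c * v x) := by
  have hfun : fourier (fun x => c * v x) = fun k => c * fourier v k :=
    funext (fourier_const_mul c v)
  rw [hfun]
  exact hv.const_mul c

lemma fourier_sum (c : ι → ℂ) (hf : ∀ i ∈ S, Integrable (f i)) :
    fourier (fun x => ∑ i ∈ S, c i * f i x) = fun k => ∑ i ∈ S, c i * fourier (f i) k := by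
  funext k
  simp only [fourier, Finset.sum_mul, mul_assoc]
  rw [integral_finsetSum S fun i hi =>
    (integrable_mul_exp_neg_I_mul_inner (hf i hi) k).const_mul (c i)]
  simp only [integral_const_mul]

lemma invFourier_eq_fourier_neg (f : Plane → ℂ) (x : Plane) :
    invFourier f x = 1 / (2 * (π : ℂ)) ^ 2 * fourier f (-x) := by
  simp [invFourier, fourier, real_inner_comm x]

lemma propagator_const_mul (s : ℝ) (c : ℂ) (f : Plane → ℂ) (x : Plane) :
    propagator s (fun y => c * f y) x = c * propagator s f x := by
  simp only [propagator, fourier_const_mul, mul_left_comm _ c, invFourier_eq_fourier_neg]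

lemma propagator_sum (s : ℝ) (c : ι → ℂ) (hf : ∀ i ∈ S, Integrable (f i))
    (hf' : ∀ i ∈ S, Integrable (fourier (f i))) :
    propagator s (fun x => ∑ i ∈ S, c i * f i x) =
      fun x => ∑ i ∈ S, c i * propagator s (f i) x := by
  have hmul (i : ι) (hi : i ∈ S) : Integrable fun k : Plane =>
      Complex.exp (-(I * (s : ℂ) * (((‖k‖ ^ 2 : ℝ)) : ℂ))) * fourier (f i) k :=
    (hf' i hi).bdd_mul (c := 1) (Continuous.aestronglyMeasurable (by fun_prop))
      (Eventually.of_forall fun k => by simp [Complex.norm_exp, -Complex.ofReal_pow])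
  funext x
  simp only [propagator, fourier_sum c hf, Finset.mul_sum, mul_left_comm _ (c _),
    invFourier_eq_fourier_neg, fourier_sum c hmul]

end Linearity

lemma fourier_gexp {A : ℂ} (hA : 0 < A.re) (w : Fin 2 → ℂ) :
    fourier (gexp A w) = fun k => π / A * Complex.exp ((∑ j, w j ^ 2) / (4 * A)) *
      gexp (4 * A)⁻¹ (fun j => -I * w j / (2 * A)) k := by
  have hA0 := ne_zero_of_re_pos hA
  funext k
  simp only [fourier, exp_neg_I_mul_inner_eq_gexp, gexp_mul_gexp, add_zero, integral_gexp hA]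
  rw [mul_assoc, gexp, ← Complex.exp_add]
  simp only [Pi.add_apply, Fin.sum_univ_two]
  congr 2
  field_simp
  ring_nf
  simp only [Complex.I_sq]
  ring

lemma integrable_fourier_gexp {A : ℂ} (hA : 0 < A.re) (w : Fin 2 → ℂ) :
    Integrable (fourier (gexp A w)) := by
  rw [fourier_gexp hA]
  exact (integrable_gexp (inv_four_mul_re_pos hA) _).const_mul _

lemma one_add_four_I_mul_ne_zero {A : ℂ} (hA : 0 < A.re) (s : ℝ) : 1 + 4 * I * s * A ≠ 0 := by
  have hA0 := ne_zero_of_re_pos hA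
  have hre : 0 < ((4 * A)⁻¹ + I * s).re := by simpa using inv_four_mul_re_pos hA
  intro h
  refine ne_zero_of_re_pos hre ?_
  field_simp
  linear_combination h

lemma div_one_add_four_I_mul_re_pos {A : ℂ} (hA : 0 < A.re) (s : ℝ) :
    0 < (A / (1 + 4 * I * s * A)).re := by
  have hA0 := ne_zero_of_re_pos hA
  have := one_add_four_I_mul_ne_zero hA s
  have hre : 0 < ((4 * A)⁻¹ + I * s).re := by simpa using inv_four_mul_re_pos hA
  convert inv_four_mul_re_pos hre using 2
  field_simp

lemma multiplier_mul_fourier_gexp {A : ℂ} (hA : 0 < A.re) (w : Fin 2 → ℂ) (s : ℝ) (k : Plane) :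
    Complex.exp (-(I * (s : ℂ) * (((‖k‖ ^ 2 : ℝ)) : ℂ))) * fourier (gexp A w) k =
      π / A * Complex.exp ((∑ j, w j ^ 2) / (4 * A)) *
        gexp ((4 * A)⁻¹ + I * s) (fun j => -I * w j / (2 * A)) k := by
  rw [fourier_gexp hA, mul_left_comm, norm_sq_eq_sum]
  simp only [gexp, ← Complex.exp_add]
  push_cast
  ring_nf

lemma propagator_gexp {A : ℂ} (hA : 0 < A.re) (w : Fin 2 → ℂ) (s : ℝ) :
    propagator s (gexp A w) = fun x =>
      1 / (1 + 4 * I * s * A) * Complex.exp (I * s * (∑ j, w j ^ 2) / (1 + 4 * I * s * A)) *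
        gexp (A / (1 + 4 * I * s * A)) (fun j => w j / (1 + 4 * I * s * A)) x := by
  have hA0 := ne_zero_of_re_pos hA
  have hπ : (π : ℂ) ≠ 0 := by exact_mod_cast Real.pi_ne_zero
  have hq := one_add_four_I_mul_ne_zero hA s
  have hB : 0 < ((4 * A)⁻¹ + I * s).re := by simpa using inv_four_mul_re_pos hA
  have hBq : (4 * A)⁻¹ + I * s = (1 + 4 * I * s * A) / (4 * A) := by field_simp
  funext x
  rw [propagator, invFourier_eq_fourier_neg]
  simp only [multiplier_mul_fourier_gexp hA]
  rw [fourier_const_mul, fourier_gexp hB, hBq]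
  generalize hq' : 1 + 4 * I * s * A = q at hq ⊢
  have hexp : Complex.exp (I * s * (∑ j, w j ^ 2) / q) *
      gexp (A / q) (fun j => w j / q) x =
      Complex.exp ((∑ j, w j ^ 2) / (4 * A)) *
        (Complex.exp ((∑ j, (-I * w j / (2 * A)) ^ 2) / (4 * (q / (4 * A)))) *
          gexp (4 * (q / (4 * A)))⁻¹ (fun j => -I * (-I * w j / (2 * A)) / (2 * (q / (4 * A))))
            (-x)) := by
    simp only [gexp, ← Complex.exp_add, Fin.sum_univ_two, PiLp.neg_apply, Complex.ofReal_neg]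
    congr 1
    field_simp
    rw [← hq']
    ring_nf
    simp only [Complex.I_sq]
    ring
  rw [mul_assoc (1 / q), hexp]
  field_simp
  ring

section CoarseGraining

variable {σ : ℝ}

lemma exp_neg_mul_norm_sub_sq_eq_gexp (β : ℝ) (K k : Plane) :
    ((Real.exp (-β * ‖k - K‖ ^ 2) : ℝ) : ℂ) =
      Complex.exp (-β * ∑ j, (K j : ℂ) ^ 2) * gexp β (fun j => 2 * β * K j) k := by
  simp only [norm_sq_eq_sum, gexp, ← Complex.exp_add, Fin.sum_univ_two, PiLp.sub_apply]
  push_cast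
  ring_nf

lemma integrable_exp_neg_mul_norm_sub_sq {β : ℝ} (hβ : 0 < β) (K : Plane) :
    Integrable fun k : Plane => ((Real.exp (-β * ‖k - K‖ ^ 2) : ℝ) : ℂ) := by
  simp only [exp_neg_mul_norm_sub_sq_eq_gexp]
  exact (integrable_gexp (by simpa using hβ) _).const_mul _

lemma fourier_exp_neg_mul_norm_sub_sq (hσ : 0 < σ) (K x : Plane) :
    ∫ k : Plane, ((Real.exp (-(1 / (2 * σ ^ 2)) * ‖k - K‖ ^ 2) : ℝ) : ℂ) *
      Complex.exp (-(I * ((inner ℝ k x : ℝ) : ℂ))) =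
    2 * π * σ ^ 2 * gexp (σ ^ 2 / 2) (fun j => -I * K j) x := by
  have hσ0 : (σ : ℂ) ≠ 0 := by exact_mod_cast hσ.ne'
  have hre : 0 < ((1 / (2 * σ ^ 2) : ℝ) : ℂ).re := by
    rw [Complex.ofReal_re]
    positivity
  simp only [exp_neg_mul_norm_sub_sq_eq_gexp, real_inner_comm x, exp_neg_I_mul_inner_eq_gexp,
    mul_assoc (Complex.exp _), gexp_mul_gexp, add_zero]
  rw [integral_const_mul, integral_gexp hre, mul_left_comm, ← Complex.exp_add, gexp]
  simp only [Pi.add_apply, Fin.sum_univ_two]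
  push_cast
  congr 1
  · field_simp
  · congr 1
    field_simp
    ring_nf
    simp only [Complex.I_sq]
    ring

/-- By Fubini, coarse graining is the pairing with a Gaussian wave packet of width `1 / σ`. -/
lemma coarse_eq_integral (hσ : 0 < σ) (K : Plane) {v : Plane → ℂ} (hv : Integrable v) :
    coarse v K σ =
      2 * π * σ ^ 2 * ∫ x, v x * gexp (σ ^ 2 / 2) (fun j => -I * K j) x := by
  have hweight := integrable_exp_neg_mul_norm_sub_sq (β := 1 / (2 * σ ^ 2)) (by positivity) K
  have hint : Integrable (Function.uncurry fun k x : Plane =>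
      ((Real.exp (-(1 / (2 * σ ^ 2)) * ‖k - K‖ ^ 2) : ℝ) : ℂ) *
        (v x * Complex.exp (-(I * ((inner ℝ k x : ℝ) : ℂ))))) := by
    refine ((hweight.mul_prod hv).mul_bdd (c := 1)
      (g := fun p : Plane × Plane => Complex.exp (-(I * ((inner ℝ p.1 p.2 : ℝ) : ℂ))))
      (Continuous.aestronglyMeasurable (by fun_prop))
      (Eventually.of_forall fun p => (norm_exp_neg_I_mul_inner p.1 p.2).le)).congr ?_
    exact Eventually.of_forall fun p => mul_assoc _ _ _
  simp only [coarse, fourier, ← integral_const_mul]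
  rw [integral_integral_swap hint]
  congr 1
  funext x
  simp only [mul_left_comm _ (v x), integral_const_mul, fourier_exp_neg_mul_norm_sub_sq hσ]

lemma norm_gexp_packet_le_one (σ : ℝ) (K x : Plane) :
    ‖gexp (σ ^ 2 / 2) (fun j => -I * K j) x‖ ≤ 1 := by
  rw [gexp, Complex.norm_exp, Real.exp_le_one_iff]
  have hre : (-((σ : ℂ) ^ 2 / 2) * ∑ j, (x j : ℂ) ^ 2 + ∑ j, -I * K j * x j).re =
      -(σ ^ 2 / 2 * ∑ j, x j ^ 2) := by
    simp [← Complex.ofReal_pow]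
  rw [hre]
  exact neg_nonpos.2 (by positivity)

lemma integrable_mul_gexp_packet {v : Plane → ℂ} (hv : Integrable v) (σ : ℝ) (K : Plane) :
    Integrable fun x => v x * gexp (σ ^ 2 / 2) (fun j => -I * K j) x :=
  hv.mul_bdd (c := 1)
    (continuous_gexp_comp continuous_const continuous_const continuous_id).aestronglyMeasurable
    (Eventually.of_forall (norm_gexp_packet_le_one σ K))

lemma coarse_integral {T : Type*} [MeasurableSpace T] {μ : Measure T} [SFinite μ] (hσ : 0 < σ)
    (K : Plane) {F : T → Plane → ℂ} (hF : Integrable (Function.uncurry F) (μ.prod volume)) :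
    coarse (fun x => ∫ s, F s x ∂μ) K σ = ∫ s, coarse (F s) K σ ∂μ := by
  have hmarginal : Integrable fun x => ∫ s, F s x ∂μ := hF.integral_prod_right
  rw [coarse_eq_integral hσ K hmarginal]
  have hcoarse : ∀ᵐ s ∂μ, coarse (F s) K σ =
      2 * π * σ ^ 2 * ∫ x, F s x * gexp (σ ^ 2 / 2) (fun j => -I * K j) x :=
    hF.prod_right_ae.mono fun s hs => coarse_eq_integral hσ K hs
  rw [integral_congr_ae hcoarse, integral_const_mul, integral_integral_swap]
  · simp only [integral_mul_const]
  · exact hF.mul_bdd (c := 1)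
      (g := fun p : T × Plane => gexp (σ ^ 2 / 2) (fun j => -I * K j) p.2)
      ((continuous_gexp_comp continuous_const continuous_const
        continuous_id).aestronglyMeasurable.comp_snd)
      (Eventually.of_forall fun p => norm_gexp_packet_le_one σ K p.2)

lemma coarse_sum {ι : Type*} {S : Finset ι} {f : ι → Plane → ℂ} (hσ : 0 < σ) (K : Plane)
    (c : ι → ℂ) (hf : ∀ i ∈ S, Integrable (f i)) :
    coarse (fun x => ∑ i ∈ S, c i * f i x) K σ = ∑ i ∈ S, c i * coarse (f i) K σ := by
  have hsum : Integrable fun x => ∑ i ∈ S, c i * f i x :=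
    integrable_finsetSum S fun i hi => (hf i hi).const_mul (c i)
  rw [coarse_eq_integral hσ K hsum]
  simp only [Finset.sum_mul, mul_assoc (c _)]
  rw [integral_finsetSum S fun i hi =>
    (integrable_mul_gexp_packet (hf i hi) σ K).const_mul (c i), Finset.mul_sum]
  refine Finset.sum_congr rfl fun i hi => ?_
  rw [integral_const_mul, coarse_eq_integral hσ K (hf i hi), mul_left_comm]

lemma coarse_const_mul (σ : ℝ) (K : Plane) (c : ℂ) (v : Plane → ℂ) :
    coarse (fun x => c * v x) K σ = c * coarse v K σ := by
  simp only [coarse, fourier_const_mul, mul_left_comm _ c, integral_const_mul]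

lemma coarse_gexp (hσ : 0 < σ) (K : Plane) {A : ℂ} (hA : 0 < A.re) (w : Fin 2 → ℂ) :
    coarse (gexp A w) K σ = 4 * π ^ 2 * σ ^ 2 / (σ ^ 2 + 2 * A) *
      Complex.exp ((∑ j, (w j - I * K j) ^ 2) / (2 * (σ ^ 2 + 2 * A))) := by
  have hre : 0 < (A + σ ^ 2 / 2).re := by
    have : (((σ : ℂ) ^ 2 / 2)).re = σ ^ 2 / 2 := by simp [← Complex.ofReal_pow]
    rw [Complex.add_re, this]
    positivity
  have := ne_zero_of_re_pos hre
  have hden : (σ : ℂ) ^ 2 + 2 * A = 2 * (A + σ ^ 2 / 2) := by ring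
  rw [coarse_eq_integral hσ K (integrable_gexp hA w)]
  simp only [gexp_mul_gexp, integral_gexp hre, hden, Pi.add_apply, neg_mul, ← sub_eq_add_neg]
  rw [← mul_assoc]
  congr 1
  · field_simp
    ring
  · congr 2
    ring

end CoarseGraining

/-- Finite combinations of Gaussians whose parameters depend continuously on the time are
dominated, over a compact time interval, by a single integrable Gaussian. -/
lemma integrable_prod_mul_gexp {c A : ℝ → ℂ} {w : ℝ → Fin 2 → ℂ} (hc : Continuous c)
    (hA : Continuous A) (hw : Continuous w) (hpos : ∀ s, 0 < (A s).re) {t : ℝ} (ht : 0 ≤ t) :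
    Integrable (Function.uncurry fun s x => c s * gexp (A s) (w s) x)
      ((volume.restrict (Set.Ioc 0 t)).prod volume) := by
  have hne : (Set.Icc 0 t).Nonempty := Set.nonempty_Icc.2 ht
  obtain ⟨s₀, -, hs₀⟩ :=
    isCompact_Icc.exists_isMinOn hne (Complex.continuous_re.comp hA).continuousOn
  obtain ⟨B, hB⟩ := (isCompact_Icc (a := 0) (b := t)).exists_bound_of_continuousOn hw.continuousOn
  obtain ⟨C, hC⟩ := (isCompact_Icc (a := 0) (b := t)).exists_bound_of_continuousOn hc.continuousOn
  set m := (A s₀).re / 2 with hm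
  have hm0 : 0 < m := half_pos (hpos s₀)
  have hdom : Integrable (fun p : ℝ × Plane =>
      C * (Real.exp (B ^ 2 / (2 * m)) * ‖gexp m 0 p.2‖))
      ((volume.restrict (Set.Ioc 0 t)).prod volume) :=
    (((integrable_gexp (by simpa using hm0) 0).norm.comp_snd _).const_mul _).const_mul C
  refine hdom.mono' ?_ ?_
  · exact ((hc.comp continuous_fst).mul (continuous_gexp_comp (hA.comp continuous_fst)
      (hw.comp continuous_fst) continuous_snd)).aestronglyMeasurable
  · have hmem : ∀ᵐ p ∂(volume.restrict (Set.Ioc 0 t)).prod (volume : Measure Plane),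
        p.1 ∈ Set.Ioc 0 t :=
      Measure.quasiMeasurePreserving_fst.ae (ae_restrict_mem measurableSet_Ioc)
    filter_upwards [hmem] with p hp
    have hp' := Set.Ioc_subset_Icc_self hp
    have hmin : 2 * m ≤ (A p.1).re := by
      rw [hm, mul_div_cancel₀ _ two_ne_zero]
      exact hs₀ hp'
    rw [Function.uncurry, norm_mul]
    exact mul_le_mul (hC _ hp') (norm_gexp_le hm0 hmin (hB _ hp') p.2) (norm_nonneg _)
      ((norm_nonneg _).trans (hC _ hp'))

/-! ### The exact first order term -/

/-- The factor `1 / (1 + 2ish²)` by which the free flow up to time `s` spreads a Gaussian of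
width `1 / h`. -/
def damp (h s : ℝ) : ℂ := 1 / (1 + 2 * I * s * h ^ 2)

/-- The complex inverse square width of a product `u ū u` of three packets evolved up to time
`s`. -/
def tripleWidth (h s : ℝ) : ℂ := h ^ 2 / 2 * (2 * damp h s + damp h (-s))

/-- The complex inverse square width `1/(2σ²) - is`, in frequency, of the coarse graining weight
moved back to time `s`. -/
def testWidth (σ s : ℝ) : ℂ := 1 / (2 * σ ^ 2) - I * s

/-- The factor by which the coarse graining weight broadens the product of three packets. -/
def smear (h σ s : ℝ) : ℂ := 1 + 4 * testWidth σ s * tripleWidth h s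

/-- The frequency of a product `u ū u` of packets with frequencies `k₁`, `k₂`, `k₃` evolved up to
time `s`, in one coordinate. It equals `k₁ - k₂ + k₃` at `s = 0`. -/
def tripleFreq (h s k₁ k₂ k₃ : ℝ) : ℂ := damp h s * k₁ - damp h (-s) * k₂ + damp h s * k₃

/-- The exponent of the interaction at time `s` of packets with frequencies `k₁`, `k₂`, `k₃` in
one coordinate, relative to the frequency of the coarse graining. -/
def exponent (h σ s k₁ k₂ k₃ : ℝ) : ℂ :=
  -I * s * (damp h s * k₁ ^ 2 - damp h (-s) * k₂ ^ 2 + damp h s * k₃ ^ 2) -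
    testWidth σ s * tripleFreq h s k₁ k₂ k₃ ^ 2 / smear h σ s

/-- The interaction at time `s` of the packets at `p.1`, `p.2.1`, `p.2.2` observed at `K`. -/
def packet (h σ : ℝ) (K : Plane) (p : Plane × Plane × Plane) (s : ℝ) : ℂ :=
  damp h s ^ 2 * damp h (-s) / smear h σ s *
    Complex.exp (∑ j, exponent h σ s (p.1 j - K j) (p.2.1 j - K j) (p.2.2 j - K j))

lemma one_add_two_I_mul_ne_zero (h s : ℝ) : 1 + 2 * I * s * h ^ 2 ≠ 0 := by
  intro hzero
  simpa [← Complex.ofReal_pow] using congrArg Complex.re hzero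

lemma two_I_mul_damp (h s : ℝ) : 2 * I * s * h ^ 2 * damp h s = 1 - damp h s := by
  have hne := one_add_two_I_mul_ne_zero h s
  rw [damp]
  field_simp
  ring

lemma two_I_mul_damp_neg (h s : ℝ) : 2 * I * s * h ^ 2 * damp h (-s) = damp h (-s) - 1 := by
  have hdamp := two_I_mul_damp h (-s)
  push_cast at hdamp
  linear_combination -hdamp

lemma conj_damp (h s : ℝ) : (starRingEnd ℂ) (damp h s) = damp h (-s) := by
  simp [damp, Complex.conj_ofNat]

@[fun_prop]
lemma continuous_damp (h : ℝ) : Continuous (damp h) := by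
  unfold damp
  exact continuous_const.div (by fun_prop) (one_add_two_I_mul_ne_zero h)

lemma damp_re_pos (h s : ℝ) : 0 < (damp h s).re := by
  rw [damp, one_div]
  exact inv_re_pos (by simp [← Complex.ofReal_pow])

lemma tripleWidth_re_pos {h : ℝ} (hh : 0 < h) (s : ℝ) : 0 < (tripleWidth h s).re := by
  have hsum : 0 < (2 * damp h s + damp h (-s)).re := by
    simpa using add_pos (mul_pos two_pos (damp_re_pos h s)) (damp_re_pos h (-s))
  have hreal : tripleWidth h s = ((h ^ 2 / 2 : ℝ) : ℂ) * (2 * damp h s + damp h (-s)) := by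
    rw [tripleWidth]
    push_cast
    rfl
  rw [hreal, Complex.re_ofReal_mul]
  positivity

@[fun_prop]
lemma continuous_tripleWidth (h : ℝ) : Continuous (tripleWidth h) := by
  unfold tripleWidth
  fun_prop

@[fun_prop]
lemma continuous_smear (h σ : ℝ) : Continuous (smear h σ) := by
  unfold smear testWidth
  fun_prop

@[fun_prop]
lemma continuous_tripleFreq (h k₁ k₂ k₃ : ℝ) : Continuous fun s => tripleFreq h s k₁ k₂ k₃ := by
  unfold tripleFreq
  fun_prop

lemma one_add_four_I_mul_tripleWidth (h s : ℝ) :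
    1 + 4 * I * ((-s : ℝ) : ℂ) * tripleWidth h s = 2 * damp h s - damp h (-s) := by
  rw [tripleWidth]
  push_cast
  linear_combination -2 * two_I_mul_damp h s - two_I_mul_damp_neg h s

lemma two_damp_sub_ne_zero {h : ℝ} (hh : 0 < h) (s : ℝ) : 2 * damp h s - damp h (-s) ≠ 0 := by
  rw [← one_add_four_I_mul_tripleWidth]
  exact one_add_four_I_mul_ne_zero (tripleWidth_re_pos hh s) (-s)

lemma tripleWidth_div_re_pos {h : ℝ} (hh : 0 < h) (s : ℝ) :
    0 < (tripleWidth h s / (2 * damp h s - damp h (-s))).re := by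
  rw [← one_add_four_I_mul_tripleWidth]
  exact div_one_add_four_I_mul_re_pos (tripleWidth_re_pos hh s) (-s)

lemma testWidth_re (σ s : ℝ) : (testWidth σ s).re = 1 / (2 * σ ^ 2) := by
  have hreal : testWidth σ s = ((1 / (2 * σ ^ 2) : ℝ) : ℂ) - I * s := by
    rw [testWidth]
    push_cast
    rfl
  rw [hreal, Complex.sub_re, Complex.ofReal_re, Complex.I_mul_re, Complex.ofReal_im, neg_zero,
    sub_zero]

lemma smear_ne_zero {h σ : ℝ} (hh : 0 < h) (hσ : 0 < σ) (s : ℝ) : smear h σ s ≠ 0 := by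
  have hA := ne_zero_of_re_pos (tripleWidth_re_pos hh s)
  have hre : 0 < ((4 * tripleWidth h s)⁻¹ + testWidth σ s).re := by
    rw [Complex.add_re, testWidth_re]
    exact add_pos (inv_four_mul_re_pos (tripleWidth_re_pos hh s)) (by positivity)
  intro hzero
  refine ne_zero_of_re_pos hre ?_
  rw [smear] at hzero
  field_simp
  linear_combination hzero

/-- Completing the square: since `k₁ - k₂ + k₃` is unaffected by a Galilean boost composed with
`k`, the interaction only depends on the frequencies relative to `k`. -/
lemma exponent_sub_eq {h σ : ℝ} (hh : 0 < h) (hσ : 0 < σ) (s k₁ k₂ k₃ k : ℝ) :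
    exponent h σ s (k₁ - k) (k₂ - k) (k₃ - k) =
      -I * s * (damp h s * k₁ ^ 2 - damp h (-s) * k₂ ^ 2 + damp h s * k₃ ^ 2) +
        I * s * tripleFreq h s k₁ k₂ k₃ ^ 2 / (2 * damp h s - damp h (-s)) -
        (tripleFreq h s k₁ k₂ k₃ / (2 * damp h s - damp h (-s)) - k) ^ 2 *
          (2 * damp h s - damp h (-s)) / (2 * σ ^ 2 * smear h σ s) := by
  have hρ := two_damp_sub_ne_zero hh s
  have hQ := smear_ne_zero hh hσ s
  have hσ0 : (σ : ℂ) ≠ 0 := by exact_mod_cast hσ.ne'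
  have hwidth := one_add_four_I_mul_tripleWidth h s
  have hshift : tripleFreq h s (k₁ - k) (k₂ - k) (k₃ - k) =
      tripleFreq h s k₁ k₂ k₃ - (2 * damp h s - damp h (-s)) * k := by
    simp only [tripleFreq]
    push_cast
    ring
  have hkey : I * s * smear h σ s - 1 / (2 * σ ^ 2) =
      -testWidth σ s * (2 * damp h s - damp h (-s)) := by
    rw [← hwidth, smear, testWidth]
    push_cast
    ring
  have hquad : damp h s * ((k₁ - k : ℝ) : ℂ) ^ 2 - damp h (-s) * ((k₂ - k : ℝ) : ℂ) ^ 2 +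
      damp h s * ((k₃ - k : ℝ) : ℂ) ^ 2 =
      damp h s * k₁ ^ 2 - damp h (-s) * k₂ ^ 2 + damp h s * k₃ ^ 2 -
        2 * k * tripleFreq h s k₁ k₂ k₃ + (2 * damp h s - damp h (-s)) * k ^ 2 := by
    simp only [tripleFreq]
    push_cast
    ring
  rw [exponent, hquad, hshift]
  generalize tripleFreq h s k₁ k₂ k₃ = c
  generalize 2 * damp h s - damp h (-s) = ρ at *
  field_simp at hkey ⊢
  linear_combination -(c - ρ * k) ^ 2 * hkey

lemma continuous_packet {h σ : ℝ} (hh : 0 < h) (hσ : 0 < σ) (K : Plane)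
    (p : Plane × Plane × Plane) : Continuous (packet h σ K p) := by
  have hQ := smear_ne_zero hh hσ
  unfold packet exponent testWidth
  fun_prop (disch := exact hQ _)

lemma gauss_eq_gexp (K : Plane) (h : ℝ) :
    gauss K h = fun x => 1 / (2 * (π : ℂ)) ^ 2 * gexp (h ^ 2 / 2) (fun j => I * K j) x := by
  funext x
  rw [gauss, mul_assoc, Complex.ofReal_exp, ← Complex.exp_add, gexp, norm_sq_eq_sum,
    inner_eq_sum]
  simp only [Fin.sum_univ_two]
  congr 2
  push_cast
  ring

section Datum

variable {η : Plane → ℂ} {L : ℝ} {S : Finset Plane}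

lemma initialDatum_eq_sum (hS : ∀ K ∈ S, K ∈ lattice L)
    (hη : ∀ K ∈ lattice L, K ∉ S → η K = 0) (h : ℝ) :
    initialDatum η h L = fun x => ∑ K ∈ S, η K * gauss K h x := by
  funext x
  rw [initialDatum, tsum_subtype (lattice L) (fun K => η K * gauss K h x), tsum_eq_sum (s := S)]
  · exact Finset.sum_congr rfl fun K hK => Set.indicator_of_mem (hS K hK) _
  · intro K hK
    by_cases hL : K ∈ lattice L
    · rw [Set.indicator_of_mem hL, hη K hL hK, zero_mul]
    · rw [Set.indicator_of_notMem hL]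

open Classical in
lemma interactionSum_eq_sum (hS : ∀ K ∈ S, K ∈ lattice L)
    (hη : ∀ K ∈ lattice L, K ∉ S → η K = 0) (K : Plane) (t : ℝ) :
    interactionSum η L K t = ∑ p ∈ S ×ˢ S ×ˢ S, η p.1 * (starRingEnd ℂ) (η p.2.1) * η p.2.2 *
      if K = p.1 - p.2.1 + p.2.2 then oscillation t (resonance p.1 p.2.1 p.2.2 K) else 0 := by
  rw [interactionSum, tsum_subtype (interactions L K) (fun p : Plane × Plane × Plane =>
    η p.1 * (starRingEnd ℂ) (η p.2.1) * η p.2.2 *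
      oscillation t (resonance p.1 p.2.1 p.2.2 K)), tsum_eq_sum (s := S ×ˢ S ×ˢ S)]
  · refine Finset.sum_congr rfl fun p hp => ?_
    simp only [Finset.mem_product] at hp
    by_cases hK : K = p.1 - p.2.1 + p.2.2
    · rw [Set.indicator_of_mem (show p ∈ interactions L K from
        ⟨hS _ hp.1, hS _ hp.2.1, hS _ hp.2.2, hK⟩), if_pos hK]
    · rw [Set.indicator_of_notMem fun hp : p ∈ interactions L K => hK hp.2.2.2, if_neg hK,
        mul_zero]
  · intro p hp
    by_cases hpK : p ∈ interactions L K
    · rw [Set.indicator_of_mem hpK]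
      simp only [Finset.mem_product, not_and_or] at hp
      rcases hp with hp | hp | hp
      · simp [hη _ hpK.1 hp]
      · simp [hη _ hpK.2.1 hp]
      · simp [hη _ hpK.2.2.1 hp]
    · rw [Set.indicator_of_notMem hpK]

end Datum

lemma gaussWidth_re_pos {h : ℝ} (hh : 0 < h) : 0 < ((h : ℂ) ^ 2 / 2).re := by
  have hpos : 0 < h ^ 2 / 2 := by positivity
  exact_mod_cast hpos

lemma integrable_gauss {h : ℝ} (hh : 0 < h) (K : Plane) : Integrable (gauss K h) := by
  rw [gauss_eq_gexp]
  exact (integrable_gexp (gaussWidth_re_pos hh) _).const_mul _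

lemma integrable_fourier_gauss {h : ℝ} (hh : 0 < h) (K : Plane) :
    Integrable (fourier (gauss K h)) := by
  rw [gauss_eq_gexp]
  exact integrable_fourier_const_mul (integrable_fourier_gexp (gaussWidth_re_pos hh) _) _

lemma propagator_gauss {h : ℝ} (hh : 0 < h) (K : Plane) (s : ℝ) :
    propagator s (gauss K h) = fun x =>
      1 / (2 * (π : ℂ)) ^ 2 * (damp h s * Complex.exp (-I * s * damp h s * ∑ j, (K j : ℂ) ^ 2)) *
        gexp (h ^ 2 / 2 * damp h s) (fun j => I * damp h s * K j) x := by
  have hdiv (z : ℂ) : z / (1 + 4 * I * s * (h ^ 2 / 2)) = z * damp h s := by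
    rw [damp]
    ring_nf
  have hphase : I * s * (∑ j, (I * K j) ^ 2) * damp h s =
      -I * s * damp h s * ∑ j, (K j : ℂ) ^ 2 := by
    simp only [mul_pow, Complex.I_sq, ← Finset.mul_sum]
    ring
  funext x
  rw [gauss_eq_gexp, propagator_const_mul, propagator_gexp (gaussWidth_re_pos hh)]
  simp only [hdiv, one_mul, hphase, mul_right_comm I _ (damp h s)]
  ring

/-- The product `u ū u` of the packets at `p.1`, `p.2.1`, `p.2.2` evolved up to time `s`. -/
def tripleProduct (h : ℝ) (p : Plane × Plane × Plane) (s : ℝ) (x : Plane) : ℂ :=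
  propagator s (gauss p.1 h) x * (starRingEnd ℂ) (propagator s (gauss p.2.1 h) x) *
    propagator s (gauss p.2.2 h) x

/-- The amplitude at the origin of a product of three evolved packets. -/
def tripleAmp (h : ℝ) (p : Plane × Plane × Plane) (s : ℝ) : ℂ :=
  (1 / (2 * (π : ℂ)) ^ 2) ^ 3 * (damp h s ^ 2 * damp h (-s)) *
    Complex.exp (∑ j, -I * s * (damp h s * p.1 j ^ 2 - damp h (-s) * p.2.1 j ^ 2 +
      damp h s * p.2.2 j ^ 2))

lemma norm_sq_mul_propagator_sum {h : ℝ} (hh : 0 < h) (η : Plane → ℂ) (S : Finset Plane)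
    (s : ℝ) (x : Plane) :
    ((‖propagator s (fun y => ∑ K ∈ S, η K * gauss K h y) x‖ ^ 2 : ℝ) : ℂ) *
      propagator s (fun y => ∑ K ∈ S, η K * gauss K h y) x =
    ∑ p ∈ S ×ˢ S ×ˢ S,
      η p.1 * (starRingEnd ℂ) (η p.2.1) * η p.2.2 * tripleProduct h p s x := by
  rw [propagator_sum s η (fun K _ => integrable_gauss hh K)
    fun K _ => integrable_fourier_gauss hh K]
  simp only [← Complex.normSq_eq_norm_sq, ← Complex.mul_conj]
  rw [mul_assoc, map_sum, Finset.sum_mul_sum, ← Finset.sum_product', Finset.sum_mul_sum,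
    ← Finset.sum_product']
  refine Finset.sum_congr rfl fun p _ => ?_
  rw [map_mul, tripleProduct]
  ring

lemma tripleProduct_eq_gexp {h : ℝ} (hh : 0 < h) (p : Plane × Plane × Plane) (s : ℝ) :
    tripleProduct h p s = fun x => tripleAmp h p s *
      gexp (tripleWidth h s) (fun j => I * tripleFreq h s (p.1 j) (p.2.1 j) (p.2.2 j)) x := by
  have hamp : Complex.exp (∑ j, -I * s * (damp h s * p.1 j ^ 2 - damp h (-s) * p.2.1 j ^ 2 +
      damp h s * p.2.2 j ^ 2)) =
      Complex.exp (-I * s * damp h s * ∑ j, (p.1 j : ℂ) ^ 2) *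
        Complex.exp (I * s * damp h (-s) * ∑ j, (p.2.1 j : ℂ) ^ 2) *
        Complex.exp (-I * s * damp h s * ∑ j, (p.2.2 j : ℂ) ^ 2) := by
    simp only [← Complex.exp_add, Fin.sum_univ_two]
    ring_nf
  funext x
  have hgexp : gexp (tripleWidth h s)
      (fun j => I * tripleFreq h s (p.1 j) (p.2.1 j) (p.2.2 j)) x =
      gexp (h ^ 2 / 2 * damp h s) (fun j => I * damp h s * p.1 j) x *
        gexp (h ^ 2 / 2 * damp h (-s)) (fun j => -I * damp h (-s) * p.2.1 j) x *
        gexp (h ^ 2 / 2 * damp h s) (fun j => I * damp h s * p.2.2 j) x := by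
    simp only [gexp, tripleWidth, tripleFreq, ← Complex.exp_add, Fin.sum_univ_two]
    ring_nf
  rw [tripleAmp, hamp, hgexp]
  simp only [tripleProduct, propagator_gauss hh, map_mul, conj_gexp, conj_damp, map_div₀, map_pow,
    map_neg, map_one, map_sum, Complex.conj_ofReal, Complex.conj_I, Complex.conj_ofNat, neg_neg,
    ← Complex.exp_conj]
  ring

lemma integrable_tripleProduct {h : ℝ} (hh : 0 < h) (p : Plane × Plane × Plane) (s : ℝ) :
    Integrable (tripleProduct h p s) := by
  rw [tripleProduct_eq_gexp hh]
  exact (integrable_gexp (tripleWidth_re_pos hh s) _).const_mul _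

lemma integrable_fourier_tripleProduct {h : ℝ} (hh : 0 < h) (p : Plane × Plane × Plane)
    (s : ℝ) : Integrable (fourier (tripleProduct h p s)) := by
  rw [tripleProduct_eq_gexp hh]
  exact integrable_fourier_const_mul (integrable_fourier_gexp (tripleWidth_re_pos hh s) _) _

lemma propagator_tripleProduct {h : ℝ} (hh : 0 < h) (p : Plane × Plane × Plane) (s : ℝ) :
    propagator (-s) (tripleProduct h p s) = fun x =>
      tripleAmp h p s / (2 * damp h s - damp h (-s)) *
        Complex.exp (I * s * (∑ j, tripleFreq h s (p.1 j) (p.2.1 j) (p.2.2 j) ^ 2) /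
          (2 * damp h s - damp h (-s))) *
        gexp (tripleWidth h s / (2 * damp h s - damp h (-s)))
          (fun j => I * tripleFreq h s (p.1 j) (p.2.1 j) (p.2.2 j) /
            (2 * damp h s - damp h (-s))) x := by
  funext x
  rw [tripleProduct_eq_gexp hh, propagator_const_mul, propagator_gexp (tripleWidth_re_pos hh s)]
  simp only [one_add_four_I_mul_tripleWidth]
  simp only [mul_pow, Complex.I_sq, ← Finset.mul_sum, Complex.ofReal_neg]
  ring_nf

lemma integrable_propagator_tripleProduct {h : ℝ} (hh : 0 < h) (p : Plane × Plane × Plane)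
    (s : ℝ) : Integrable (propagator (-s) (tripleProduct h p s)) := by
  rw [propagator_tripleProduct hh]
  exact (integrable_gexp (tripleWidth_div_re_pos hh s) _).const_mul _

lemma integrable_prod_propagator_tripleProduct {h : ℝ} (hh : 0 < h) (p : Plane × Plane × Plane)
    {t : ℝ} (ht : 0 ≤ t) :
    Integrable (Function.uncurry fun s => propagator (-s) (tripleProduct h p s))
      ((volume.restrict (Set.Ioc 0 t)).prod volume) := by
  have hρ : Continuous fun s => 2 * damp h s - damp h (-s) := by fun_prop
  have hρ0 := two_damp_sub_ne_zero hh
  have hamp : Continuous (tripleAmp h p) := by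
    unfold tripleAmp
    fun_prop
  simp only [propagator_tripleProduct hh]
  exact integrable_prod_mul_gexp ((hamp.div hρ hρ0).mul
    (Complex.continuous_exp.comp (Continuous.div (by fun_prop) hρ hρ0)))
    (Continuous.div (by fun_prop) hρ hρ0)
    (continuous_pi fun j => Continuous.div (by fun_prop) hρ hρ0) (tripleWidth_div_re_pos hh) ht

lemma coarse_propagator_tripleProduct {h σ : ℝ} (hh : 0 < h) (hσ : 0 < σ) (K : Plane)
    (p : Plane × Plane × Plane) (s : ℝ) :
    coarse (propagator (-s) (tripleProduct h p s)) K σ =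
      1 / (2 * (π : ℂ)) ^ 4 * packet h σ K p s := by
  have hρ := two_damp_sub_ne_zero hh s
  have hQ := smear_ne_zero hh hσ s
  have hσ0 : (σ : ℂ) ≠ 0 := by exact_mod_cast hσ.ne'
  have hπ : (π : ℂ) ≠ 0 := by exact_mod_cast Real.pi_ne_zero
  have hden : (σ : ℂ) ^ 2 + 2 * (tripleWidth h s / (2 * damp h s - damp h (-s))) =
      σ ^ 2 * smear h σ s / (2 * damp h s - damp h (-s)) := by
    have hwidth := one_add_four_I_mul_tripleWidth h s
    push_cast at hwidth
    rw [smear, testWidth]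
    field_simp
    linear_combination -2 * σ ^ 2 * hwidth
  have hexp : Complex.exp (∑ j, exponent h σ s (p.1 j - K j) (p.2.1 j - K j) (p.2.2 j - K j)) =
      Complex.exp (∑ j, -I * s * (damp h s * p.1 j ^ 2 - damp h (-s) * p.2.1 j ^ 2 +
        damp h s * p.2.2 j ^ 2)) *
      Complex.exp (I * s * (∑ j, tripleFreq h s (p.1 j) (p.2.1 j) (p.2.2 j) ^ 2) /
        (2 * damp h s - damp h (-s))) *
      Complex.exp ((∑ j, (I * tripleFreq h s (p.1 j) (p.2.1 j) (p.2.2 j) /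
        (2 * damp h s - damp h (-s)) - I * K j) ^ 2) /
          (2 * (σ ^ 2 * smear h σ s / (2 * damp h s - damp h (-s))))) := by
    simp only [exponent_sub_eq hh hσ, ← Complex.exp_add, mul_div_assoc I, ← mul_sub, mul_pow,
      Complex.I_sq, Fin.sum_univ_two]
    congr 1
    field_simp
    ring
  rw [propagator_tripleProduct hh, coarse_const_mul, coarse_gexp hσ K (tripleWidth_div_re_pos hh s),
    hden, packet, tripleAmp, hexp]
  field_simp
  ring

lemma coarse_firstOrder {η : Plane → ℂ} {L : ℝ} {S : Finset Plane}
    (hS : ∀ K ∈ S, K ∈ lattice L) (hη : ∀ K ∈ lattice L, K ∉ S → η K = 0) {h σ t : ℝ}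
    (hh : 0 < h) (hσ : 0 < σ) (ht : 0 ≤ t) (K : Plane) :
    coarse (firstOrder (initialDatum η h L) t) K σ = (1 / (2 * (π : ℂ)) ^ 4) *
      ∑ p ∈ S ×ˢ S ×ˢ S, η p.1 * (starRingEnd ℂ) (η p.2.1) * η p.2.2 *
        ∫ s in (0 : ℝ)..t, packet h σ K p s := by
  set c : Plane × Plane × Plane → ℂ := fun p => η p.1 * (starRingEnd ℂ) (η p.2.1) * η p.2.2
  have hfirst : firstOrder (initialDatum η h L) t = fun x => ∫ s in Set.Ioc 0 t,
      ∑ p ∈ S ×ˢ S ×ˢ S, c p * propagator (-s) (tripleProduct h p s) x := by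
    funext x
    simp only [firstOrder, intervalIntegral.integral_of_le ht, initialDatum_eq_sum hS hη,
      norm_sq_mul_propagator_sum hh]
    simp only [propagator_sum _ c (fun p _ => integrable_tripleProduct hh p _)
      fun p _ => integrable_fourier_tripleProduct hh p _, c]
  have hint : Integrable (Function.uncurry fun s x =>
      ∑ p ∈ S ×ˢ S ×ˢ S, c p * propagator (-s) (tripleProduct h p s) x)
      ((volume.restrict (Set.Ioc 0 t)).prod volume) :=
    integrable_finsetSum _ fun p _ =>
      (integrable_prod_propagator_tripleProduct hh p ht).const_mul (c p)
  have hcoarse (s : ℝ) : coarse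
      (fun x => ∑ p ∈ S ×ˢ S ×ˢ S, c p * propagator (-s) (tripleProduct h p s) x) K σ =
      1 / (2 * (π : ℂ)) ^ 4 * ∑ p ∈ S ×ˢ S ×ˢ S, c p * packet h σ K p s := by
    rw [coarse_sum hσ K c fun p _ => integrable_propagator_tripleProduct hh p s, Finset.mul_sum]
    exact Finset.sum_congr rfl fun p _ => by
      rw [coarse_propagator_tripleProduct hh hσ, mul_left_comm]
  rw [hfirst, coarse_integral hσ K hint]
  simp only [hcoarse, ← intervalIntegral.integral_of_le ht]
  rw [intervalIntegral.integral_const_mul, intervalIntegral.integral_finsetSum fun p _ =>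
    ((continuous_packet hh hσ K p).const_mul (c p)).intervalIntegrable 0 t]
  simp only [intervalIntegral.integral_const_mul, c]

lemma oscillation_eq_integral (t ω : ℝ) :
    oscillation t ω = ∫ s in (0 : ℝ)..t, Complex.exp (-(I * s * ω)) := by
  have hlin (s : ℝ) : -(I * s * ω) = -(I * ω) * s := by ring
  rw [oscillation]
  split_ifs with hω
  · simp [hω]
  · have hne : -(I * ω) ≠ 0 := by simp [hω]
    simp only [hlin, integral_exp_mul_complex hne, Complex.ofReal_zero, mul_zero,
      Complex.exp_zero]
    rw [← neg_div_neg_eq]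
    ring_nf

/-! ### Pointwise bounds on packet interactions -/

section Bounds

variable {h σ s : ℝ}

lemma norm_damp_le (h s : ℝ) : ‖damp h s‖ ≤ 1 := by
  rw [damp, norm_div, norm_one]
  refine div_le_one_of_le₀ ?_ (norm_nonneg _)
  calc 1 = |(1 + 2 * I * (s : ℂ) * (h : ℂ) ^ 2).re| := by simp [← Complex.ofReal_pow]
    _ ≤ ‖1 + 2 * I * (s : ℂ) * (h : ℂ) ^ 2‖ := Complex.abs_re_le_norm _

lemma norm_damp_sub_one_le (h s : ℝ) : ‖damp h s - 1‖ ≤ 2 * |s| * h ^ 2 := by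
  rw [norm_sub_rev, ← two_I_mul_damp, norm_mul]
  calc ‖2 * I * (s : ℂ) * (h : ℂ) ^ 2‖ * ‖damp h s‖
      ≤ ‖2 * I * (s : ℂ) * (h : ℂ) ^ 2‖ * 1 := by gcongr; exact norm_damp_le h s
    _ = 2 * |s| * h ^ 2 := by simp

lemma damp_re (h s : ℝ) : (damp h s).re = 1 / (1 + 4 * s ^ 2 * h ^ 4) := by
  rw [damp, one_div, Complex.inv_re, Complex.normSq_apply]
  simp [← Complex.ofReal_pow]
  ring

lemma norm_tripleWidth_le (h s : ℝ) : ‖tripleWidth h s‖ ≤ 3 / 2 * h ^ 2 := by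
  have hsum : ‖2 * damp h s + damp h (-s)‖ ≤ 2 * 1 + 1 := by
    refine norm_add_le_of_le ?_ (norm_damp_le h (-s))
    rw [norm_mul, Complex.norm_ofNat]
    gcongr
    exact norm_damp_le h s
  have hfactor : ‖(h : ℂ) ^ 2 / 2‖ = h ^ 2 / 2 := by simp
  rw [tripleWidth, norm_mul, hfactor]
  calc h ^ 2 / 2 * ‖2 * damp h s + damp h (-s)‖ ≤ h ^ 2 / 2 * (2 * 1 + 1) := by gcongr
    _ = 3 / 2 * h ^ 2 := by ring

lemma norm_testWidth_le (hσ : 0 < σ) (hs : 0 ≤ s) (hsσ : s * σ ^ 2 ≤ 1) :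
    ‖testWidth σ s‖ ≤ 3 / 2 / σ ^ 2 := by
  have hs' : s ≤ 1 / σ ^ 2 := by rwa [le_div_iff₀ (by positivity)]
  calc ‖testWidth σ s‖ ≤ ‖1 / (2 * (σ : ℂ) ^ 2)‖ + ‖I * (s : ℂ)‖ := norm_sub_le _ _
    _ = 1 / 2 / σ ^ 2 + s := by simp [abs_of_nonneg hs]; ring
    _ ≤ 1 / 2 / σ ^ 2 + 1 / σ ^ 2 := by gcongr
    _ = 3 / 2 / σ ^ 2 := by ring

lemma ratio_sq_le (hh : 0 < h) (hσ : 0 < σ) (hr : 16 * h ≤ σ) : h ^ 2 / σ ^ 2 ≤ 1 / 256 := by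
  rw [div_le_div_iff₀ (by positivity) (by norm_num)]
  nlinarith

lemma mul_sq_le_one (hh : 0 < h) (hs : 0 ≤ s) (hr : 16 * h ≤ σ) (hsσ : s * σ ^ 2 ≤ 1) :
    s * h ^ 2 ≤ 1 := by
  refine le_trans ?_ hsσ
  gcongr
  linarith

lemma norm_smear_sub_one_le (hσ : 0 < σ) (hs : 0 ≤ s) (hsσ : s * σ ^ 2 ≤ 1) :
    ‖smear h σ s - 1‖ ≤ 9 * (h ^ 2 / σ ^ 2) := by
  rw [smear, add_sub_cancel_left, norm_mul, norm_mul, Complex.norm_ofNat]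
  calc 4 * ‖testWidth σ s‖ * ‖tripleWidth h s‖ ≤ 4 * (3 / 2 / σ ^ 2) * (3 / 2 * h ^ 2) := by
        gcongr
        exacts [norm_testWidth_le hσ hs hsσ, norm_tripleWidth_le h s]
    _ = 9 * (h ^ 2 / σ ^ 2) := by ring

lemma norm_inv_smear_le (hh : 0 < h) (hσ : 0 < σ) (hs : 0 ≤ s) (hr : 16 * h ≤ σ)
    (hsσ : s * σ ^ 2 ≤ 1) : ‖(smear h σ s)⁻¹‖ ≤ 2 := by
  have hclose := norm_smear_sub_one_le (h := h) hσ hs hsσ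
  have hratio := ratio_sq_le hh hσ hr
  have htri : (1 : ℝ) ≤ ‖smear h σ s‖ + ‖smear h σ s - 1‖ := by
    simpa using norm_sub_le (smear h σ s) (smear h σ s - 1)
  rw [norm_inv]
  refine inv_le_of_inv_le₀ (by norm_num) ?_
  linarith

lemma norm_damp_div_smear_le (hh : 0 < h) (hσ : 0 < σ) (hs : 0 ≤ s) (hr : 16 * h ≤ σ)
    (hsσ : s * σ ^ 2 ≤ 1) : ‖damp h s ^ 2 * damp h (-s) / smear h σ s‖ ≤ 2 := by
  rw [div_eq_mul_inv, norm_mul, norm_mul, norm_pow]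
  calc ‖damp h s‖ ^ 2 * ‖damp h (-s)‖ * ‖(smear h σ s)⁻¹‖ ≤ 1 ^ 2 * 1 * 2 := by
        gcongr
        exacts [norm_damp_le h s, norm_damp_le h (-s), norm_inv_smear_le hh hσ hs hr hsσ]
    _ = 2 := by norm_num

/-- The first order coefficient, up to the factor `-2ish²`, in the drift of the frequency of a
product `u ū u` of packets away from its initial value `k₁ - k₂ + k₃`. -/
def tripleDrift (h s k₁ k₂ k₃ : ℝ) : ℂ := damp h s * k₁ + damp h (-s) * k₂ + damp h s * k₃

lemma tripleFreq_eq (h s k₁ k₂ k₃ : ℝ) :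
    tripleFreq h s k₁ k₂ k₃ = (k₁ - k₂ + k₃) - 2 * I * s * h ^ 2 * tripleDrift h s k₁ k₂ k₃ := by
  rw [tripleFreq, tripleDrift]
  linear_combination (k₁ + k₃ : ℂ) * two_I_mul_damp h s + k₂ * two_I_mul_damp_neg h s

lemma norm_tripleDrift_le {k₁ k₂ k₃ D : ℝ} (h s : ℝ) (h₁ : |k₁| ≤ D) (h₂ : |k₂| ≤ D)
    (h₃ : |k₃| ≤ D) : ‖tripleDrift h s k₁ k₂ k₃‖ ≤ 3 * D := by
  have hterm : ∀ r k : ℝ, |k| ≤ D → ‖damp h r * (k : ℂ)‖ ≤ 1 * D := fun r k hk =>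
    norm_mul_le_of_le (norm_damp_le h r) (by simpa using hk)
  refine norm_add₃_le.trans ?_
  linarith [hterm s k₁ h₁, hterm (-s) k₂ h₂, hterm s k₃ h₃]

/-- The part of the exponent which the Gaussian `-(k₁ - k₂ + k₃)²/(2σ²)`, the phase and the
decay of the individual packets leave over. -/
def broadening (h σ s k₁ k₂ k₃ : ℝ) : ℂ :=
  testWidth σ s * (smear h σ s)⁻¹ *
    (4 * testWidth σ s * tripleWidth h s * (k₁ - k₂ + k₃) ^ 2 +
      (4 * I * s * h ^ 2 * (k₁ - k₂ + k₃) * tripleDrift h s k₁ k₂ k₃ +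
        4 * s ^ 2 * h ^ 4 * tripleDrift h s k₁ k₂ k₃ ^ 2))

lemma exponent_eq (hh : 0 < h) (hσ : 0 < σ) (s k₁ k₂ k₃ : ℝ) :
    exponent h σ s k₁ k₂ k₃ =
      I * ((-s * (k₁ ^ 2 - k₂ ^ 2 + k₃ ^ 2) : ℝ) : ℂ) +
        (((-(k₁ - k₂ + k₃) ^ 2 : ℝ) : ℂ) * testWidth σ s + broadening h σ s k₁ k₂ k₃) -
        ((2 * s ^ 2 * h ^ 2 : ℝ) : ℂ) *
          (((k₁ ^ 2 + k₃ ^ 2 : ℝ) : ℂ) * damp h s + ((k₂ ^ 2 : ℝ) : ℂ) * damp h (-s)) := by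
  have hinv := mul_inv_cancel₀ (smear_ne_zero hh hσ s)
  have hphase : I * s * (damp h s * k₁ ^ 2 - damp h (-s) * k₂ ^ 2 + damp h s * k₃ ^ 2) =
      I * s * (k₁ ^ 2 - k₂ ^ 2 + k₃ ^ 2) +
        2 * s ^ 2 * h ^ 2 * ((k₁ ^ 2 + k₃ ^ 2) * damp h s + k₂ ^ 2 * damp h (-s)) := by
    linear_combination I * s * (k₁ ^ 2 + k₃ ^ 2) * two_I_mul_damp h s +
      I * s * k₂ ^ 2 * two_I_mul_damp_neg h s - 2 * s ^ 2 * h ^ 2 *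
        ((k₁ ^ 2 + k₃ ^ 2) * damp h s + k₂ ^ 2 * damp h (-s)) * Complex.I_sq
  have hsmear : smear h σ s = 1 + 4 * testWidth σ s * tripleWidth h s := rfl
  rw [exponent, broadening, tripleFreq_eq, div_eq_mul_inv]
  generalize tripleDrift h s k₁ k₂ k₃ = T
  push_cast
  linear_combination -hphase - testWidth σ s * (k₁ - k₂ + k₃) ^ 2 * (hinv -
    (smear h σ s)⁻¹ * hsmear) - 4 * testWidth σ s * (smear h σ s)⁻¹ * s ^ 2 * h ^ 4 * T ^ 2 *
      Complex.I_sq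

lemma norm_broadening_le {k₁ k₂ k₃ D : ℝ} (hh : 0 < h) (hσ : 0 < σ) (hs : 0 ≤ s)
    (hr : 16 * h ≤ σ) (hsσ : s * σ ^ 2 ≤ 1) (h₁ : |k₁| ≤ D) (h₂ : |k₂| ≤ D) (h₃ : |k₃| ≤ D) :
    ‖broadening h σ s k₁ k₂ k₃‖ ≤ 27 * (k₁ - k₂ + k₃) ^ 2 * (h ^ 2 / σ ^ 4) +
      36 * s * (|k₁ - k₂ + k₃| * D) + 108 * s * D ^ 2 := by
  have hD : 0 ≤ D := (abs_nonneg _).trans h₁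
  have hratio := ratio_sq_le hh hσ hr
  have htest := norm_testWidth_le hσ hs hsσ
  have hwidth := norm_tripleWidth_le h s
  have hdrift := norm_tripleDrift_le h s h₁ h₂ h₃
  have hinv := norm_inv_smear_le hh hσ hs hr hsσ
  rw [broadening, ← Complex.ofReal_sub, ← Complex.ofReal_add]
  generalize k₁ - k₂ + k₃ = P
  refine (norm_mul_le_of_le (norm_mul_le_of_le htest hinv)
    (norm_add_le_of_le (r₁ := 4 * (3 / 2 / σ ^ 2) * (3 / 2 * h ^ 2) * P ^ 2) ?_
      (norm_add_le_of_le (r₁ := 4 * s * h ^ 2 * |P| * (3 * D))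
        (r₂ := 4 * s ^ 2 * h ^ 4 * (3 * D) ^ 2) ?_ ?_))).trans ?_
  iterate 3
    simp only [norm_mul, norm_pow, Complex.norm_real, Complex.norm_ofNat, Real.norm_eq_abs,
      Complex.norm_I, abs_of_nonneg hs, abs_of_pos hh, sq_abs, mul_one]
    gcongr
  calc 3 / 2 / σ ^ 2 * 2 * (4 * (3 / 2 / σ ^ 2) * (3 / 2 * h ^ 2) * P ^ 2 +
        (4 * s * h ^ 2 * |P| * (3 * D) + 4 * s ^ 2 * h ^ 4 * (3 * D) ^ 2))
      = 27 * P ^ 2 * (h ^ 2 / σ ^ 4) + 36 * s * (|P| * D) * (h ^ 2 / σ ^ 2) +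
          108 * s * D ^ 2 * ((s * σ ^ 2) * (h ^ 2 / σ ^ 2) ^ 2) := by
        field_simp
        ring
    _ ≤ 27 * P ^ 2 * (h ^ 2 / σ ^ 4) + 36 * s * (|P| * D) * 1 +
          108 * s * D ^ 2 * (1 * 1 ^ 2) := by
        gcongr <;> linarith
    _ = 27 * P ^ 2 * (h ^ 2 / σ ^ 4) + 36 * s * (|P| * D) + 108 * s * D ^ 2 := by ring

lemma re_exponent_le {k₁ k₂ k₃ D : ℝ} (hh : 0 < h) (hσ : 0 < σ) (hs : 0 ≤ s)
    (hr : 16 * h ≤ σ) (hsσ : s * σ ^ 2 ≤ 1) (h₁ : |k₁| ≤ D) (h₂ : |k₂| ≤ D) (h₃ : |k₃| ≤ D) :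
    (exponent h σ s k₁ k₂ k₃).re ≤ -(k₁ - k₂ + k₃) ^ 2 / (2 * σ ^ 2) +
      27 * (k₁ - k₂ + k₃) ^ 2 * (h ^ 2 / σ ^ 4) + 36 * s * (|k₁ - k₂ + k₃| * D) +
      108 * s * D ^ 2 := by
  have hbroad := (Complex.re_le_norm _).trans (norm_broadening_le hh hσ hs hr hsσ h₁ h₂ h₃)
  have hdecay : 0 ≤ 2 * s ^ 2 * h ^ 2 *
      ((k₁ ^ 2 + k₃ ^ 2) * (damp h s).re + k₂ ^ 2 * (damp h (-s)).re) := by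
    have hpos := damp_re_pos h s
    have hneg := damp_re_pos h (-s)
    positivity
  rw [exponent_eq hh hσ, Complex.sub_re, Complex.add_re, Complex.add_re, Complex.re_ofReal_mul,
    Complex.re_ofReal_mul, Complex.add_re, Complex.re_ofReal_mul, Complex.re_ofReal_mul,
    testWidth_re, Complex.I_mul_re, Complex.ofReal_im, mul_one_div]
  linarith

lemma norm_packet_le {D : ℝ} {K : Plane} {p : Plane × Plane × Plane} (hh : 0 < h)
    (hσ : 0 < σ) (hs : 0 ≤ s) (hr : 16 * h ≤ σ) (hsσ : s * σ ^ 2 ≤ 1)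
    (h₁ : ‖p.1 - K‖ ≤ D) (h₂ : ‖p.2.1 - K‖ ≤ D) (h₃ : ‖p.2.2 - K‖ ≤ D) :
    ‖packet h σ K p s‖ ≤ 2 * Real.exp (-‖p.1 - p.2.1 + p.2.2 - K‖ ^ 2 / (2 * σ ^ 2) +
      27 * ‖p.1 - p.2.1 + p.2.2 - K‖ ^ 2 * (h ^ 2 / σ ^ 4) +
      72 * s * (‖p.1 - p.2.1 + p.2.2 - K‖ * D) + 216 * s * D ^ 2) := by
  have hD : 0 ≤ D := (norm_nonneg _).trans h₁
  have hcoord : ∀ (x : Plane) (j : Fin 2), |x j| ≤ ‖x‖ := fun x j => by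
    simpa using PiLp.norm_apply_le x j
  rw [packet, norm_mul, Complex.norm_exp, Complex.re_sum]
  gcongr
  · exact norm_damp_div_smear_le hh hσ hs hr hsσ
  set P := p.1 - p.2.1 + p.2.2 - K with hP
  calc ∑ j, (exponent h σ s (p.1 j - K j) (p.2.1 j - K j) (p.2.2 j - K j)).re
      ≤ ∑ j, (-P j ^ 2 / (2 * σ ^ 2) + 27 * P j ^ 2 * (h ^ 2 / σ ^ 4) +
          36 * s * (‖P‖ * D) + 108 * s * D ^ 2) := by
        refine Finset.sum_le_sum fun j _ => ?_
        have hPj : (p.1 - K) j - (p.2.1 - K) j + (p.2.2 - K) j = P j := by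
          simp only [hP, PiLp.sub_apply, PiLp.add_apply]
          ring
        refine (re_exponent_le hh hσ hs hr hsσ ((hcoord (p.1 - K) j).trans h₁)
          ((hcoord (p.2.1 - K) j).trans h₂) ((hcoord (p.2.2 - K) j).trans h₃)).trans ?_
        rw [hPj]
        gcongr
        exact hcoord P j
    _ = -‖P‖ ^ 2 / (2 * σ ^ 2) + 27 * ‖P‖ ^ 2 * (h ^ 2 / σ ^ 4) + 72 * s * (‖P‖ * D) +
          216 * s * D ^ 2 := by
        rw [norm_sq_eq_sum]
        simp only [Fin.sum_univ_two]
        ring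

end Bounds

/-! ### Resonant triples: slow modulation of the phase -/

/-- Quantitative differentiability at a point: `f` is differentiable at `s`, with `‖f s‖ ≤ M` and
`‖f' s‖ ≤ M'`. -/
def C1Bound (f : ℝ → ℂ) (s M M' : ℝ) : Prop :=
  ‖f s‖ ≤ M ∧ ∃ f' : ℂ, HasDerivAt f f' s ∧ ‖f'‖ ≤ M'

namespace C1Bound

variable {f g : ℝ → ℂ} {s M M' N N' : ℝ}

lemma mono (hf : C1Bound f s M M') (hM : M ≤ N) (hM' : M' ≤ N') : C1Bound f s N N' :=
  ⟨hf.1.trans hM, hf.2.imp fun _ hd => ⟨hd.1, hd.2.trans hM'⟩⟩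

lemma add (hf : C1Bound f s M M') (hg : C1Bound g s N N') :
    C1Bound (fun r => f r + g r) s (M + N) (M' + N') := by
  obtain ⟨hM, f', hf', hM'⟩ := hf
  obtain ⟨hN, g', hg', hN'⟩ := hg
  exact ⟨norm_add_le_of_le hM hN, f' + g', hf'.add hg', norm_add_le_of_le hM' hN'⟩

lemma sub (hf : C1Bound f s M M') (hg : C1Bound g s N N') :
    C1Bound (fun r => f r - g r) s (M + N) (M' + N') := by
  obtain ⟨hM, f', hf', hM'⟩ := hf
  obtain ⟨hN, g', hg', hN'⟩ := hg
  exact ⟨norm_sub_le_of_le hM hN, f' - g', hf'.sub hg', norm_sub_le_of_le hM' hN'⟩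

lemma mul (hf : C1Bound f s M M') (hg : C1Bound g s N N') :
    C1Bound (fun r => f r * g r) s (M * N) (M' * N + M * N') := by
  obtain ⟨hM, f', hf', hM'⟩ := hf
  obtain ⟨hN, g', hg', hN'⟩ := hg
  exact ⟨norm_mul_le_of_le hM hN, _, hf'.mul hg',
    norm_add_le_of_le (norm_mul_le_of_le hM' hN) (norm_mul_le_of_le hM hN')⟩

lemma sq (hf : C1Bound f s M M') : C1Bound (fun r => f r ^ 2) s (M ^ 2) (2 * M * M') := by
  simp_rw [pow_two]
  exact (hf.mul hf).mono le_rfl (by linarith)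

lemma const_mul (c : ℂ) (hf : C1Bound f s M M') :
    C1Bound (fun r => c * f r) s (‖c‖ * M) (‖c‖ * M') := by
  obtain ⟨hM, f', hf', hM'⟩ := hf
  exact ⟨norm_mul_le_of_le le_rfl hM, _, hf'.const_mul c, norm_mul_le_of_le le_rfl hM'⟩

lemma inv (hf : C1Bound f s M M') (h0 : f s ≠ 0) (hN : ‖(f s)⁻¹‖ ≤ N) :
    C1Bound (fun r => (f r)⁻¹) s N (N ^ 2 * M') := by
  obtain ⟨-, f', hf', hM'⟩ := hf
  refine ⟨hN, _, hf'.inv h0, ?_⟩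
  rw [norm_div, norm_neg, norm_pow, div_eq_inv_mul, ← inv_pow, ← norm_inv]
  gcongr

lemma cexp (hf : C1Bound f s M M') (hre : (f s).re ≤ 0) :
    C1Bound (fun r => Complex.exp (f r)) s 1 M' := by
  obtain ⟨-, f', hf', hM'⟩ := hf
  have hexp : ‖Complex.exp (f s)‖ ≤ 1 := by
    rw [Complex.norm_exp]
    exact Real.exp_le_one_iff.2 hre
  exact ⟨hexp, _, hf'.cexp, by simpa using norm_mul_le_of_le hexp hM'⟩

end C1Bound

/-- The exponent left over from a resonant interaction once the oscillation `e^{-isΔω}` has been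
split off; here `x` and `y` stand for `|K₂ - K|²` and `|K₁ - K|² + |K₃ - K|²`. -/
def slowExponent (h σ x y s : ℝ) : ℂ :=
  (4 * h ^ 4 * x : ℝ) *
      (s ^ 2 * (testWidth σ s * (smear h σ s)⁻¹) * (damp h s + damp h (-s)) ^ 2) -
    (2 * h ^ 2 : ℝ) * (s ^ 2 * (y * damp h s + x * damp h (-s)))

/-- The relative error in replacing a resonant packet interaction by the oscillation
`e^{-isΔω}`. -/
def deviation (h σ x y s : ℝ) : ℂ :=
  Complex.exp (slowExponent h σ x y s) * (damp h s ^ 2 * damp h (-s) * (smear h σ s)⁻¹) - 1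

section Resonant

variable {h σ s : ℝ}

lemma exponent_resonant (hh : 0 < h) (hσ : 0 < σ) (s k₁ k₃ : ℝ) :
    exponent h σ s k₁ (k₁ + k₃) k₃ = I * ((-s * (k₁ ^ 2 - (k₁ + k₃) ^ 2 + k₃ ^ 2) : ℝ) : ℂ) +
      slowExponent h σ ((k₁ + k₃) ^ 2) (k₁ ^ 2 + k₃ ^ 2) s := by
  rw [exponent_eq hh hσ, broadening, tripleDrift, slowExponent]
  push_cast
  ring

lemma packet_resonant {K : Plane} {p : Plane × Plane × Plane} (hh : 0 < h) (hσ : 0 < σ)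
    (hK : K = p.1 - p.2.1 + p.2.2) (s : ℝ) :
    packet h σ K p s = Complex.exp (-(I * s * resonance p.1 p.2.1 p.2.2 K)) *
      (deviation h σ (‖p.2.1 - K‖ ^ 2) (‖p.1 - K‖ ^ 2 + ‖p.2.2 - K‖ ^ 2) s + 1) := by
  have hcoord : ∀ j, p.2.1 j - K j = (p.1 j - K j) + (p.2.2 j - K j) := by
    intro j
    simp only [hK, PiLp.add_apply, PiLp.sub_apply]
    ring
  have hsum : ∑ j, exponent h σ s (p.1 j - K j) (p.2.1 j - K j) (p.2.2 j - K j) =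
      -(I * s * resonance p.1 p.2.1 p.2.2 K) +
        slowExponent h σ (‖p.2.1 - K‖ ^ 2) (‖p.1 - K‖ ^ 2 + ‖p.2.2 - K‖ ^ 2) s := by
    simp only [hcoord, exponent_resonant hh hσ, Fin.sum_univ_two, resonance, slowExponent,
      norm_sq_eq_sum, PiLp.sub_apply]
    rw [eq_add_of_sub_eq (hcoord 0), eq_add_of_sub_eq (hcoord 1)]
    push_cast
    ring
  rw [packet, deviation, sub_add_cancel, hsum, Complex.exp_add, div_eq_mul_inv]
  ring

lemma c1Bound_ofReal (hs : 0 ≤ s) : C1Bound (fun r : ℝ => (r : ℂ)) s s 1 :=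
  ⟨by simp [abs_of_nonneg hs], 1, Complex.ofRealCLM.hasDerivAt, by simp⟩

lemma hasDerivAt_damp (h s : ℝ) : HasDerivAt (damp h) (-(2 * I * h ^ 2) * damp h s ^ 2) s := by
  have hdenom : HasDerivAt (fun r : ℝ => 1 + 2 * I * (r : ℂ) * (h : ℂ) ^ 2) (2 * I * h ^ 2) s := by
    simpa using (((Complex.ofRealCLM.hasDerivAt (x := s)).const_mul (2 * I)).mul_const
      ((h : ℂ) ^ 2)).const_add (1 : ℂ)
  have hdamp : damp h = fun r : ℝ => (1 + 2 * I * (r : ℂ) * (h : ℂ) ^ 2)⁻¹ :=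
    funext fun r => one_div _
  rw [hdamp]
  refine (hdenom.inv (one_add_two_I_mul_ne_zero h s)).congr_deriv ?_
  rw [div_eq_mul_inv, inv_pow]

lemma c1Bound_damp (h s : ℝ) : C1Bound (damp h) s 1 (2 * h ^ 2) := by
  refine ⟨norm_damp_le h s, _, hasDerivAt_damp h s, ?_⟩
  rw [norm_mul, norm_pow]
  calc ‖-(2 * I * (h : ℂ) ^ 2)‖ * ‖damp h s‖ ^ 2 ≤ ‖-(2 * I * (h : ℂ) ^ 2)‖ * 1 ^ 2 := by
        gcongr
        exact norm_damp_le h s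
    _ = 2 * h ^ 2 := by simp

lemma c1Bound_damp_neg (h s : ℝ) : C1Bound (fun r => damp h (-r)) s 1 (2 * h ^ 2) := by
  obtain ⟨-, f', hf', hbound⟩ := c1Bound_damp h (-s)
  exact ⟨norm_damp_le h (-s), _, hf'.scomp s (hasDerivAt_neg s), by simpa using hbound⟩

lemma c1Bound_testWidth (hσ : 0 < σ) (hs : 0 ≤ s) (hsσ : s * σ ^ 2 ≤ 1) :
    C1Bound (testWidth σ) s (3 / 2 / σ ^ 2) 1 :=
  ⟨norm_testWidth_le hσ hs hsσ, -(I * 1),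
    ((Complex.ofRealCLM.hasDerivAt (x := s)).const_mul I).const_sub _, by simp⟩

lemma c1Bound_tripleWidth (h s : ℝ) : C1Bound (tripleWidth h) s (3 / 2 * h ^ 2) (3 * h ^ 4) := by
  refine ((((c1Bound_damp h s).const_mul 2).add (c1Bound_damp_neg h s)).const_mul
    ((h : ℂ) ^ 2 / 2)).mono (le_of_eq ?_) (le_of_eq ?_) <;>
  · simp only [norm_div, norm_pow, Complex.norm_real, Real.norm_eq_abs, sq_abs,
      Complex.norm_ofNat]
    ring

lemma c1Bound_inv_smear (hh : 0 < h) (hσ : 0 < σ) (hs : 0 ≤ s) (hr : 16 * h ≤ σ)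
    (hsσ : s * σ ^ 2 ≤ 1) : C1Bound (fun r => (smear h σ r)⁻¹) s 2 (40 * h ^ 2) := by
  have hratio := ratio_sq_le hh hσ hr
  have hsmear : C1Bound (smear h σ) s ‖smear h σ s‖ (10 * h ^ 2) := by
    obtain ⟨-, f', hf', hbound⟩ :=
      ((c1Bound_testWidth hσ hs hsσ).const_mul 4).mul (c1Bound_tripleWidth h s)
    refine ⟨le_rfl, f', hf'.const_add 1, hbound.trans ?_⟩
    rw [Complex.norm_ofNat]
    calc 4 * 1 * (3 / 2 * h ^ 2) + 4 * (3 / 2 / σ ^ 2) * (3 * h ^ 4)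
        = 6 * h ^ 2 + 18 * (h ^ 2 / σ ^ 2) * h ^ 2 := by ring
      _ ≤ 6 * h ^ 2 + 18 * (1 / 256) * h ^ 2 := by gcongr
      _ ≤ 10 * h ^ 2 := by linarith [sq_nonneg h]
  exact (hsmear.inv (smear_ne_zero hh hσ s) (norm_inv_smear_le hh hσ hs hr hsσ)).mono le_rfl
    (by linarith)

lemma c1Bound_sq_mul_testWidth_mul (hh : 0 < h) (hσ : 0 < σ) (hs : 0 ≤ s) (hr : 16 * h ≤ σ)
    (hsσ : s * σ ^ 2 ≤ 1) :
    C1Bound (fun r : ℝ => (r : ℂ) ^ 2 * (testWidth σ r * (smear h σ r)⁻¹) *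
      (damp h r + damp h (-r)) ^ 2) s (12 * s ^ 2 / σ ^ 2) (84 * s / σ ^ 2) := by
  have hratio := ratio_sq_le hh hσ hr
  have hsh := mul_sq_le_one hh hs hr hsσ
  have hwidth : C1Bound (fun r => testWidth σ r * (smear h σ r)⁻¹) s (3 / σ ^ 2) 3 := by
    refine ((c1Bound_testWidth hσ hs hsσ).mul (c1Bound_inv_smear hh hσ hs hr hsσ)).mono
      (le_of_eq (by ring)) ?_
    calc 1 * 2 + 3 / 2 / σ ^ 2 * (40 * h ^ 2) = 2 + 60 * (h ^ 2 / σ ^ 2) := by ring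
      _ ≤ 3 := by linarith
  refine (((c1Bound_ofReal hs).sq.mul hwidth).mul
    ((c1Bound_damp h s).add (c1Bound_damp_neg h s)).sq).mono (le_of_eq (by ring)) ?_
  calc (2 * s * 1 * (3 / σ ^ 2) + s ^ 2 * 3) * (1 + 1) ^ 2 +
        s ^ 2 * (3 / σ ^ 2) * (2 * (1 + 1) * (2 * h ^ 2 + 2 * h ^ 2))
      = s / σ ^ 2 * (24 + 12 * (s * σ ^ 2) + 48 * (s * h ^ 2)) := by
        field_simp
        ring
    _ ≤ s / σ ^ 2 * (24 + 12 * 1 + 48 * 1) := by gcongr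
    _ = 84 * s / σ ^ 2 := by ring

lemma c1Bound_sq_mul_damp (hs : 0 ≤ s) (hsh : s * h ^ 2 ≤ 1) {x y : ℝ} (hx : 0 ≤ x)
    (hy : 0 ≤ y) : C1Bound (fun r : ℝ => (r : ℂ) ^ 2 * (y * damp h r + x * damp h (-r))) s
      (s ^ 2 * (x + y)) (4 * s * (x + y)) := by
  have hsum := (c1Bound_ofReal hs).sq.mul
    (((c1Bound_damp h s).const_mul (y : ℂ)).add ((c1Bound_damp_neg h s).const_mul (x : ℂ)))
  simp only [Complex.norm_real, Real.norm_of_nonneg hx, Real.norm_of_nonneg hy] at hsum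
  refine hsum.mono (le_of_eq (by ring)) ?_
  calc 2 * s * 1 * (y * 1 + x * 1) + s ^ 2 * (y * (2 * h ^ 2) + x * (2 * h ^ 2))
      = s * (x + y) * (2 + 2 * (s * h ^ 2)) := by ring
    _ ≤ s * (x + y) * (2 + 2 * 1) := by gcongr
    _ = 4 * s * (x + y) := by ring

lemma c1Bound_slowExponent (hh : 0 < h) (hσ : 0 < σ) (hs : 0 ≤ s) (hr : 16 * h ≤ σ)
    (hsσ : s * σ ^ 2 ≤ 1) {x y : ℝ} (hx : 0 ≤ x) (hy : 0 ≤ y) :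
    C1Bound (slowExponent h σ x y) s (3 * s ^ 2 * h ^ 2 * (x + y)) (12 * s * h ^ 2 * (x + y)) := by
  have hratio := ratio_sq_le hh hσ hr
  have hdiff := ((c1Bound_sq_mul_testWidth_mul hh hσ hs hr hsσ).const_mul
    ((4 * h ^ 4 * x : ℝ) : ℂ)).sub ((c1Bound_sq_mul_damp hs (mul_sq_le_one hh hs hr hsσ) hx
      hy).const_mul ((2 * h ^ 2 : ℝ) : ℂ))
  rw [Complex.norm_real, Complex.norm_real, Real.norm_of_nonneg (by positivity),
    Real.norm_of_nonneg (by positivity)] at hdiff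
  refine hdiff.mono ?_ ?_
  · calc 4 * h ^ 4 * x * (12 * s ^ 2 / σ ^ 2) + 2 * h ^ 2 * (s ^ 2 * (x + y))
        = s ^ 2 * h ^ 2 * (48 * (h ^ 2 / σ ^ 2) * x + 2 * (x + y)) := by ring
      _ ≤ s ^ 2 * h ^ 2 * (48 * (1 / 256) * x + 2 * (x + y)) := by gcongr
      _ ≤ s ^ 2 * h ^ 2 * (3 * (x + y)) := by gcongr; linarith
      _ = 3 * s ^ 2 * h ^ 2 * (x + y) := by ring
  · calc 4 * h ^ 4 * x * (84 * s / σ ^ 2) + 2 * h ^ 2 * (4 * s * (x + y))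
        = s * h ^ 2 * (336 * (h ^ 2 / σ ^ 2) * x + 8 * (x + y)) := by ring
      _ ≤ s * h ^ 2 * (336 * (1 / 256) * x + 8 * (x + y)) := by gcongr
      _ ≤ s * h ^ 2 * (12 * (x + y)) := by gcongr; linarith
      _ = 12 * s * h ^ 2 * (x + y) := by ring

lemma one_fifth_le_damp_re (hs : |s| * h ^ 2 ≤ 1) : 1 / 5 ≤ (damp h s).re := by
  have hsq : s ^ 2 * h ^ 4 ≤ 1 := by
    calc s ^ 2 * h ^ 4 = (|s| * h ^ 2) ^ 2 := by rw [mul_pow, sq_abs]; ring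
      _ ≤ 1 := pow_le_one₀ (by positivity) hs
  rw [damp_re]
  exact one_div_le_one_div_of_le (by positivity) (by linarith)

lemma re_slowExponent_nonpos (hh : 0 < h) (hσ : 0 < σ) (hs : 0 ≤ s) (hr : 16 * h ≤ σ)
    (hsσ : s * σ ^ 2 ≤ 1) {x y : ℝ} (hx : 0 ≤ x) (hy : 0 ≤ y) :
    (slowExponent h σ x y s).re ≤ 0 := by
  have hratio := ratio_sq_le hh hσ hr
  have hsh := mul_sq_le_one hh hs hr hsσ
  have hpos : 1 / 5 ≤ (damp h s).re := one_fifth_le_damp_re (by rwa [abs_of_nonneg hs])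
  have hneg : 1 / 5 ≤ (damp h (-s)).re :=
    one_fifth_le_damp_re (by rwa [abs_neg, abs_of_nonneg hs])
  have hgrowth := (Complex.re_le_norm _).trans
    (c1Bound_sq_mul_testWidth_mul hh hσ hs hr hsσ).1
  have hdecay : s ^ 2 * (y * (1 / 5) + x * (1 / 5)) ≤
      ((s : ℂ) ^ 2 * (y * damp h s + x * damp h (-s))).re := by
    rw [← Complex.ofReal_pow, Complex.re_ofReal_mul, Complex.add_re, Complex.re_ofReal_mul,
      Complex.re_ofReal_mul]
    gcongr
  rw [slowExponent, Complex.sub_re, Complex.re_ofReal_mul, Complex.re_ofReal_mul, sub_nonpos]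
  calc 4 * h ^ 4 * x *
        ((s : ℂ) ^ 2 * (testWidth σ s * (smear h σ s)⁻¹) * (damp h s + damp h (-s)) ^ 2).re
      ≤ 4 * h ^ 4 * x * (12 * s ^ 2 / σ ^ 2) := by gcongr
    _ = 2 * h ^ 2 * (s ^ 2 * (24 * (h ^ 2 / σ ^ 2) * x)) := by ring
    _ ≤ 2 * h ^ 2 * (s ^ 2 * (24 * (1 / 256) * x)) := by gcongr
    _ ≤ 2 * h ^ 2 * (s ^ 2 * (y * (1 / 5) + x * (1 / 5))) := by gcongr; linarith
    _ ≤ 2 * h ^ 2 * ((s : ℂ) ^ 2 * (y * damp h s + x * damp h (-s))).re := by gcongr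

lemma norm_exp_sub_one_le_of_re_nonpos {z : ℂ} (hz : z.re ≤ 0) : ‖Complex.exp z - 1‖ ≤ ‖z‖ := by
  simpa using (convex_halfSpace_re_le (0 : ℝ)).norm_image_sub_le_of_norm_hasDerivWithin_le
    (f := Complex.exp) (f' := Complex.exp) (C := 1) (x := 0) (y := z)
    (fun w _ => (Complex.hasDerivAt_exp w).hasDerivWithinAt)
    (fun w hw => by rw [Complex.norm_exp]; exact Real.exp_le_one_iff.2 hw)
    (by simp) hz

lemma norm_damp_mul_inv_smear_sub_one_le (hh : 0 < h) (hσ : 0 < σ) (hs : 0 ≤ s)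
    (hr : 16 * h ≤ σ) (hsσ : s * σ ^ 2 ≤ 1) :
    ‖damp h s ^ 2 * damp h (-s) * (smear h σ s)⁻¹ - 1‖ ≤
      12 * (s * h ^ 2) + 18 * (h ^ 2 / σ ^ 2) := by
  have htelescope : damp h s ^ 2 * damp h (-s) * (smear h σ s)⁻¹ - 1 =
      (damp h s * (damp h s * (damp h (-s) - 1) + (damp h s - 1)) + (damp h s - 1)) *
        (smear h σ s)⁻¹ - (smear h σ s - 1) * (smear h σ s)⁻¹ := by
    linear_combination mul_inv_cancel₀ (smear_ne_zero hh hσ s)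
  have hdamp := norm_damp_le h s
  have hpos := norm_damp_sub_one_le h s
  have hneg := norm_damp_sub_one_le h (-s)
  have hinv := norm_inv_smear_le hh hσ hs hr hsσ
  rw [abs_of_nonneg hs] at hpos
  rw [abs_neg, abs_of_nonneg hs] at hneg
  rw [htelescope]
  refine (norm_sub_le_of_le (norm_mul_le_of_le (norm_add_le_of_le (norm_mul_le_of_le hdamp
    (norm_add_le_of_le (norm_mul_le_of_le hdamp hneg) hpos)) hpos) hinv)
    (norm_mul_le_of_le (norm_smear_sub_one_le hσ hs hsσ) hinv)).trans (le_of_eq ?_)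
  ring

lemma c1Bound_deviation (hh : 0 < h) (hσ : 0 < σ) (hs : 0 ≤ s) (hr : 16 * h ≤ σ)
    (hsσ : s * σ ^ 2 ≤ 1) {x y : ℝ} (hx : 0 ≤ x) (hy : 0 ≤ y) :
    C1Bound (deviation h σ x y) s
      (6 * s ^ 2 * h ^ 2 * (x + y) + (12 * (s * h ^ 2) + 18 * (h ^ 2 / σ ^ 2)))
      (24 * s * h ^ 2 * (x + y) + 60 * h ^ 2) := by
  have hslow := c1Bound_slowExponent hh hσ hs hr hsσ hx hy
  have hre := re_slowExponent_nonpos hh hσ hs hr hsσ hx hy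
  have hprod : C1Bound (fun r => damp h r ^ 2 * damp h (-r) * (smear h σ r)⁻¹) s 2
      (52 * h ^ 2) :=
    (((c1Bound_damp h s).sq.mul (c1Bound_damp_neg h s)).mul
      (c1Bound_inv_smear hh hσ hs hr hsσ)).mono (by norm_num) (by linarith)
  constructor
  · have hsplit : deviation h σ x y s = (Complex.exp (slowExponent h σ x y s) - 1) *
        (damp h s ^ 2 * damp h (-s) * (smear h σ s)⁻¹) +
        (damp h s ^ 2 * damp h (-s) * (smear h σ s)⁻¹ - 1) := by
      rw [deviation]
      ring
    rw [hsplit]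
    refine (norm_add_le_of_le (norm_mul_le_of_le
      ((norm_exp_sub_one_le_of_re_nonpos hre).trans hslow.1) hprod.1)
      (norm_damp_mul_inv_smear_sub_one_le hh hσ hs hr hsσ)).trans (le_of_eq ?_)
    ring
  · obtain ⟨-, f', hf', hbound⟩ := (hslow.cexp hre).mul hprod
    exact ⟨f', hf'.sub_const 1, hbound.trans (by linarith [sq_nonneg h])⟩

lemma continuous_deviation (hh : 0 < h) (hσ : 0 < σ) (x y : ℝ) :
    Continuous (deviation h σ x y) := by
  unfold deviation slowExponent testWidth
  fun_prop (disch := exact smear_ne_zero hh hσ)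

end Resonant

lemma hasDerivAt_exp_neg_I_mul (ω s : ℝ) :
    HasDerivAt (fun r : ℝ => Complex.exp (-(I * r * ω)))
      (-(I * ω) * Complex.exp (-(I * s * ω))) s := by
  have hlin : HasDerivAt (fun r : ℝ => -(I * (r : ℂ) * ω)) (-(I * ω)) s := by
    simpa using (((Complex.ofRealCLM.hasDerivAt (x := s)).const_mul I).mul_const (ω : ℂ)).fun_neg
  simpa only [mul_comm] using hlin.cexp

/-- Integration by parts: up to the factor `i / ω`, the integrand is the derivative of
`e^{-isω} f` minus `e^{-isω} f'`. -/
lemma norm_integral_exp_mul_le {f : ℝ → ℂ} {t ω M M' : ℝ} (hω : ω ≠ 0) (ht : 0 ≤ t)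
    (hf : Continuous f) (hb : ∀ s ∈ Set.Icc 0 t, C1Bound f s M M') :
    ‖∫ s in (0 : ℝ)..t, Complex.exp (-(I * s * ω)) * f s‖ ≤ (2 * M + t * M') / |ω| := by
  have hωc : (I * ω : ℂ) ≠ 0 := by simp [hω]
  set e : ℝ → ℂ := fun s => Complex.exp (-(I * s * ω)) with he
  have hnorm : ∀ (s : ℝ) (z : ℂ), ‖(I * (ω : ℂ))⁻¹ * (e s * z)‖ = ‖z‖ / |ω| := by
    intro s z
    have hunit : ‖e s‖ = 1 := by simp [he, Complex.norm_exp]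
    rw [norm_mul, norm_mul, hunit, norm_inv, norm_mul, Complex.norm_I, Complex.norm_real,
      Real.norm_eq_abs, one_mul, one_mul, div_eq_inv_mul]
  have hcont : Continuous fun s => e s * f s := by fun_prop
  set G : ℝ → ℂ := fun r => (∫ s in (0 : ℝ)..r, e s * f s) + (I * ω)⁻¹ * (e r * f r) with hG
  choose! f' hf' hbound using fun s hs => (hb s hs).2
  have hderiv : ∀ s ∈ Set.Icc 0 t, HasDerivWithinAt G ((I * ω)⁻¹ * (e s * f' s))
      (Set.Icc 0 t) s := fun s hs => by
    refine (((hcont.integral_hasStrictDerivAt 0 s).hasDerivAt.add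
      (((hasDerivAt_exp_neg_I_mul ω s).mul (hf' s hs)).const_mul
        (I * ω : ℂ)⁻¹)).congr_deriv ?_).hasDerivWithinAt
    linear_combination (-(e s * f s)) * inv_mul_cancel₀ hωc
  have hincrement : ‖G t - G 0‖ ≤ M' / |ω| * (t - 0) :=
    norm_image_sub_le_of_norm_deriv_le_segment' hderiv (fun s hs => by
      rw [hnorm]
      gcongr
      exact hbound s (Set.Ico_subset_Icc_self hs)) t (Set.right_mem_Icc.2 ht)
  have hend : ∀ s ∈ Set.Icc 0 t, ‖(I * (ω : ℂ))⁻¹ * (e s * f s)‖ ≤ M / |ω| := fun s hs => by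
    rw [hnorm]
    gcongr
    exact (hb s hs).1
  have hparts : ∫ s in (0 : ℝ)..t, e s * f s =
      (G t - G 0) - (I * ω)⁻¹ * (e t * f t) + (I * ω)⁻¹ * (e 0 * f 0) := by
    simp only [hG, intervalIntegral.integral_same]
    ring
  rw [hparts]
  refine (norm_add_le_of_le (norm_sub_le_of_le hincrement (hend t (Set.right_mem_Icc.2 ht)))
    (hend 0 (Set.left_mem_Icc.2 ht))).trans (le_of_eq ?_)
  ring

/-! ### Orthogonal pairs of integer vectors -/

section Counting

open scoped Pointwise

/-- The integers of absolute value at most `N`. -/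
def intBox (N : ℕ) : Finset ℤ := Finset.Icc (-(N : ℤ)) N

lemma mem_intBox {N : ℕ} {a : ℤ} : a ∈ intBox N ↔ |a| ≤ N := by
  rw [intBox, Finset.mem_Icc, abs_le]

lemma card_intBox (N : ℕ) : (intBox N).card = 2 * N + 1 := by
  rw [intBox, Int.card_Icc]; omega

lemma sum_Icc_inv_le (N : ℕ) : ∑ x ∈ Finset.Icc 1 N, (x : ℝ)⁻¹ ≤ 1 + Real.log N := by
  simpa only [harmonic_eq_sum_Icc, Rat.cast_sum, Rat.cast_inv, Rat.cast_natCast] using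
    harmonic_le_one_add_log N

/-- Pairs of integer vectors of sup norm at most `N` that are orthogonal. -/
def orthPairs (N : ℕ) : Finset ((ℤ × ℤ) × (ℤ × ℤ)) :=
  {q ∈ (intBox N ×ˢ intBox N) ×ˢ (intBox N ×ˢ intBox N) | q.1.1 * q.2.1 + q.1.2 * q.2.2 = 0}

lemma mem_orthPairs {N : ℕ} {a b c d : ℤ} : ((a, b), (c, d)) ∈ orthPairs N ↔
    ((|a| ≤ N ∧ |b| ≤ N) ∧ |c| ≤ N ∧ |d| ≤ N) ∧ a * c + b * d = 0 := by
  simp only [orthPairs, Finset.mem_filter, Finset.mem_product, mem_intBox]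

/-- Parameters `(x, y, g, k)` of the orthogonal pairs `(g x, g y)`, `(-k y, k x)` with `|y| ≤ x`. -/
def orthParams (N : ℕ) : Finset (Σ _ : ℕ, ℤ × ℤ × ℤ) :=
  (Finset.Icc 1 N).sigma fun x => intBox x ×ˢ intBox (N / x) ×ˢ intBox (N / x)

lemma card_orthParams_le (N : ℕ) :
    ((orthParams N).card : ℝ) ≤ 27 * N ^ 2 * (1 + Real.log N) := by
  have hfiber : ∀ x ∈ Finset.Icc 1 N,
      ((intBox x ×ˢ intBox (N / x) ×ˢ intBox (N / x)).card : ℝ) ≤ 27 * N ^ 2 * (x : ℝ)⁻¹ := by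
    intro x hx
    obtain ⟨h1, h2⟩ := Finset.mem_Icc.1 hx
    have hx1 : (1 : ℝ) ≤ x := by exact_mod_cast h1
    have hxN : (x : ℝ) ≤ N := by exact_mod_cast h2
    have hfloor : ((N / x : ℕ) : ℝ) ≤ N / x := Nat.cast_div_le
    have hone : (1 : ℝ) ≤ N / x := by rwa [one_le_div (by linarith)]
    simp only [Finset.card_product, card_intBox]
    push_cast
    calc (2 * (x : ℝ) + 1) * ((2 * (N / x : ℕ) + 1) * (2 * (N / x : ℕ) + 1))
        ≤ 3 * x * (3 * (N / x) * (3 * (N / x))) := by gcongr <;> linarith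
      _ = 27 * N ^ 2 * (x : ℝ)⁻¹ := by field_simp; ring
  rw [orthParams, Finset.card_sigma, Nat.cast_sum]
  calc _ ≤ ∑ x ∈ Finset.Icc 1 N, 27 * (N : ℝ) ^ 2 * (x : ℝ)⁻¹ := Finset.sum_le_sum hfiber
    _ = 27 * N ^ 2 * ∑ x ∈ Finset.Icc 1 N, (x : ℝ)⁻¹ := by rw [Finset.mul_sum]
    _ ≤ 27 * N ^ 2 * (1 + Real.log N) := by gcongr; exact sum_Icc_inv_le N

lemma exists_of_mul_add_mul_eq_zero {a b c d : ℤ} (ha : a ≠ 0) (h : a * c + b * d = 0) :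
    ∃ (x : ℕ) (y g k : ℤ), 0 < x ∧ a = g * x ∧ b = g * y ∧ c = -(k * y) ∧ d = k * x := by
  wlog hpos : 0 < a generalizing a b
  · obtain ⟨x, y, g, k, hx, hax, hby, hc, hd⟩ :=
      this (neg_ne_zero.2 ha) (b := -b) (by linarith) (by omega)
    exact ⟨x, y, -g, k, hx, by linarith, by linarith, hc, hd⟩
  have hgcd : 0 < a.gcd b := Int.gcd_pos_of_ne_zero_left b ha
  obtain ⟨x, y, hcop, hx, hy⟩ := Int.exists_gcd_one hgcd
  have hx0 : 0 < x := pos_of_mul_pos_left (hx ▸ hpos) (by positivity)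
  have horth : x * c + y * d = 0 := by
    refine (mul_eq_zero.1 (?_ : (a.gcd b : ℤ) * _ = 0)).resolve_left (by exact_mod_cast hgcd.ne')
    linear_combination h - c * hx - d * hy
  obtain ⟨k, hk⟩ : x ∣ d :=
    (Int.isCoprime_iff_gcd_eq_one.2 hcop).dvd_of_dvd_mul_left ⟨-c, by linarith⟩
  refine ⟨x.toNat, y, a.gcd b, k, by omega, ?_, by rw [mul_comm, ← hy], ?_, ?_⟩
  · rw [Int.toNat_of_nonneg hx0.le, mul_comm, ← hx]
  · refine mul_left_cancel₀ hx0.ne' ?_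
    linear_combination horth - y * hk
  · rw [Int.toNat_of_nonneg hx0.le, mul_comm, hk]

lemma exists_mem_orthParams {N : ℕ} {a b c d : ℤ} (ha : a ≠ 0) (hab : |b| ≤ |a|) (haN : |a| ≤ N)
    (hdN : |d| ≤ N) (h : a * c + b * d = 0) :
    ∃ q ∈ orthParams N, a = q.2.2.1 * q.1 ∧ b = q.2.2.1 * q.2.1 ∧ c = -(q.2.2.2 * q.2.1) ∧
      d = q.2.2.2 * q.1 := by
  obtain ⟨x, y, g, k, hx, rfl, rfl, rfl, rfl⟩ := exists_of_mul_add_mul_eq_zero ha h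
  rw [abs_mul, Nat.abs_cast] at haN hdN
  rw [abs_mul, abs_mul, Nat.abs_cast] at hab
  have hg : 0 < |g| := abs_pos.2 (left_ne_zero_of_mul ha)
  have hxN : (x : ℤ) ≤ N := (le_mul_of_one_le_left (by positivity) hg).trans haN
  refine ⟨⟨x, y, g, k⟩, ?_, rfl, rfl, rfl, rfl⟩
  simp only [orthParams, Finset.mem_sigma, Finset.mem_product, mem_intBox, Finset.mem_Icc]
  have hdiv {z : ℤ} (hz : |z| * x ≤ N) : |z| ≤ ((N / x : ℕ) : ℤ) := by
    rw [Int.natCast_div]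
    exact (Int.le_ediv_iff_mul_le (by exact_mod_cast hx)).2 hz
  exact ⟨⟨hx, by exact_mod_cast hxN⟩, le_of_mul_le_mul_left hab hg, hdiv haN, hdiv hdN⟩

lemma orthPairs_subset (N : ℕ) : orthPairs N ⊆ {(0, 0)} ×ˢ (intBox N ×ˢ intBox N) ∪
    ((orthParams N).image (fun q =>
        ((q.2.2.1 * q.1, q.2.2.1 * q.2.1), (-(q.2.2.2 * q.2.1), q.2.2.2 * q.1))) ∪
      (orthParams N).image (fun q =>
        ((q.2.2.1 * q.2.1, q.2.2.1 * q.1), (q.2.2.2 * q.1, -(q.2.2.2 * q.2.1))))) := by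
  rintro ⟨⟨a, b⟩, ⟨c, d⟩⟩ hq
  obtain ⟨⟨⟨ha, hb⟩, hc, hd⟩, h⟩ := mem_orthPairs.1 hq
  simp only [Finset.mem_union]
  by_cases h0 : a = 0 ∧ b = 0
  · left
    simp [h0.1, h0.2, mem_intBox, hc, hd]
  right
  rcases le_total |b| |a| with hab | hab
  · left
    have ha0 : a ≠ 0 := by
      rintro rfl
      exact h0 ⟨rfl, by simpa using hab⟩
    obtain ⟨q, hmem, rfl, rfl, rfl, rfl⟩ := exists_mem_orthParams ha0 hab ha hd h
    exact Finset.mem_image_of_mem _ hmem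
  · right
    have hb0 : b ≠ 0 := by
      rintro rfl
      exact h0 ⟨by simpa using hab, rfl⟩
    obtain ⟨q, hmem, rfl, rfl, rfl, rfl⟩ :=
      exists_mem_orthParams hb0 hab hb hc ((add_comm _ _).trans h)
    exact Finset.mem_image_of_mem _ hmem

lemma card_orthPairs_le {N : ℕ} (hN : 1 ≤ N) :
    ((orthPairs N).card : ℝ) ≤ 63 * N ^ 2 * (1 + Real.log N) := by
  have hcard : (orthPairs N).card ≤
      (2 * N + 1) * (2 * N + 1) + ((orthParams N).card + (orthParams N).card) := by
    refine (Finset.card_le_card (orthPairs_subset N)).trans ((Finset.card_union_le _ _).trans ?_)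
    refine add_le_add (by simp [card_intBox]) ((Finset.card_union_le _ _).trans ?_)
    exact add_le_add Finset.card_image_le Finset.card_image_le
  have hcard' : ((orthPairs N).card : ℝ) ≤
      (2 * N + 1) * (2 * N + 1) + ((orthParams N).card + (orthParams N).card) := by
    exact_mod_cast hcard
  have hN' : (1 : ℝ) ≤ N := by exact_mod_cast hN
  have hlog : 0 ≤ Real.log N := Real.log_nonneg hN'
  have hparams := card_orthParams_le N
  nlinarith [mul_nonneg (sq_nonneg (N : ℝ)) hlog]

lemma mulEnergy_intBox_le {N : ℕ} (hN : 1 ≤ N) :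
    ((intBox N).mulEnergy (intBox N) : ℝ) ≤ 63 * N ^ 2 * (1 + Real.log N) := by
  refine le_trans (Nat.cast_le.2 ?_) (card_orthPairs_le hN)
  refine Finset.card_le_card_of_injOn (fun q => (q.1, (q.2.1, -q.2.2))) ?_ ?_
  · rintro ⟨⟨a, b⟩, c, d⟩ hq
    simp only [Finset.coe_filter, Finset.mem_product, mem_intBox, Set.mem_ofPred_eq] at hq
    simp only [Finset.mem_coe, mem_orthPairs, abs_neg]
    exact ⟨hq.1, by linarith [hq.2]⟩
  · rintro ⟨⟨a, b⟩, c, d⟩ _ ⟨⟨a', b'⟩, c', d'⟩ _ h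
    simpa using h

/-! ### Sums of reciprocals of inner products -/

lemma sum_intBox_abs_inv_le (M : ℕ) :
    ∑ k ∈ intBox M, |(k : ℝ)|⁻¹ ≤ 2 * (1 + Real.log M) := by
  have heven : (fun k : ℤ => |(k : ℝ)|⁻¹).Even := fun k => by simp
  have hrange :
      ∑ n ∈ Finset.range (M + 1), |((n : ℤ) : ℝ)|⁻¹ = ∑ n ∈ Finset.Icc 1 M, (n : ℝ)⁻¹ := by
    rw [Finset.range_eq_Ico, Finset.sum_eq_sum_Ico_succ_bot M.succ_pos,
      ← Finset.Ico_succ_right_eq_Icc]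
    simp
  rw [intBox, Finset.sum_Icc_of_even_eq_range heven, hrange]
  simpa using sum_Icc_inv_le M

lemma sum_abs_add_inv_le {N : ℕ} {V : Finset ℤ} (hV : V ⊆ intBox N) {i : ℤ} (hi : i ∈ V) :
    ∑ j ∈ V, |((i + j : ℤ) : ℝ)|⁻¹ ≤ 2 * (1 + Real.log (2 * N)) := by
  calc ∑ j ∈ V, |((i + j : ℤ) : ℝ)|⁻¹
      = ∑ k ∈ V.map (addLeftEmbedding i), |(k : ℝ)|⁻¹ := by rw [Finset.sum_map]; rfl
    _ ≤ ∑ k ∈ intBox (2 * N), |(k : ℝ)|⁻¹ := by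
      refine Finset.sum_le_sum_of_subset_of_nonneg ?_ fun _ _ _ => by positivity
      intro k hk
      obtain ⟨j, hj, rfl⟩ := Finset.mem_map.1 hk
      have hiN := mem_intBox.1 (hV hi)
      have hjN := mem_intBox.1 (hV hj)
      rw [addLeftEmbedding_apply, mem_intBox]
      push_cast
      linarith [abs_add_le i j]
    _ ≤ 2 * (1 + Real.log (2 * N)) := by
      simpa only [Nat.cast_mul, Nat.cast_ofNat] using sum_intBox_abs_inv_le (2 * N)

lemma sum_sum_mul_mul_le_of_symm {ι : Type*} {V : Finset ι} (τ : ι → ℝ) {w : ι → ι → ℝ} {C : ℝ}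
    (hw : ∀ i j, 0 ≤ w i j) (hsymm : ∀ i j, w i j = w j i) (hrow : ∀ i ∈ V, ∑ j ∈ V, w i j ≤ C) :
    ∑ i ∈ V, ∑ j ∈ V, τ i * τ j * w i j ≤ C * ∑ i ∈ V, τ i ^ 2 := by
  have hswap : ∑ i ∈ V, ∑ j ∈ V, τ j ^ 2 * w i j = ∑ i ∈ V, ∑ j ∈ V, τ i ^ 2 * w i j := by
    rw [Finset.sum_comm]
    simp_rw [hsymm]
  calc ∑ i ∈ V, ∑ j ∈ V, τ i * τ j * w i j
      ≤ ∑ i ∈ V, ∑ j ∈ V, (τ i ^ 2 * w i j / 2 + τ j ^ 2 * w i j / 2) := by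
        gcongr with i _ j _
        nlinarith [mul_nonneg (sq_nonneg (τ i - τ j)) (hw i j)]
    _ = ∑ i ∈ V, ∑ j ∈ V, τ i ^ 2 * w i j := by
        simp_rw [Finset.sum_add_distrib, ← Finset.sum_div]
        rw [hswap, add_halves]
    _ = ∑ i ∈ V, (∑ j ∈ V, w i j) * τ i ^ 2 := by simp_rw [Finset.sum_mul, mul_comm]
    _ ≤ ∑ i ∈ V, C * τ i ^ 2 := by gcongr with i hi; exact hrow i hi
    _ = C * ∑ i ∈ V, τ i ^ 2 := by rw [Finset.mul_sum]

-- Grouping by the values of the products turns the double sum into a quadratic form in their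
-- multiplicities, whose sum of squares is the multiplicative energy. Since `0⁻¹ = 0`, vanishing
-- inner products do not contribute.
lemma sum_sum_abs_inv_le {N : ℕ} (hN : 1 ≤ N) :
    ∑ p ∈ intBox N ×ˢ intBox N, ∑ q ∈ intBox N ×ˢ intBox N,
      |((p.1 * p.2 + q.1 * q.2 : ℤ) : ℝ)|⁻¹ ≤ 252 * N ^ 2 * (1 + Real.log N) ^ 2 := by
  set B := intBox N ×ˢ intBox N
  set V := intBox N * intBox N with hV
  set τ : ℤ → ℝ := fun i => ({p ∈ B | p.1 * p.2 = i}.card : ℝ)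
  have hfiber (g : ℤ → ℝ) : ∑ p ∈ B, g (p.1 * p.2) = ∑ i ∈ V, τ i * g i := by
    have hmaps : ∀ p ∈ B, p.1 * p.2 ∈ V := fun p hp =>
      Finset.mul_mem_mul (Finset.mem_product.1 hp).1 (Finset.mem_product.1 hp).2
    simp_rw [← Finset.sum_fiberwise_of_maps_to' hmaps, Finset.sum_const, nsmul_eq_mul, τ]
  have hVN : V ⊆ intBox (N ^ 2) := by
    refine Finset.mul_subset_iff.2 fun a ha b hb => ?_
    rw [mem_intBox] at ha hb ⊢
    rw [abs_mul, sq]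
    push_cast
    gcongr
  have hN' : (1 : ℝ) ≤ N := by exact_mod_cast hN
  have : 0 ≤ Real.log N := Real.log_nonneg hN'
  have hrow : ∀ i ∈ V, ∑ j ∈ V, |((i + j : ℤ) : ℝ)|⁻¹ ≤ 4 * (1 + Real.log N) := by
    intro i hi
    have hlog2 : Real.log (2 * ((N ^ 2 : ℕ) : ℝ)) = Real.log 2 + 2 * Real.log N := by
      push_cast
      rw [Real.log_mul (by norm_num) (by positivity), Real.log_pow, Nat.cast_ofNat]
    linarith [sum_abs_add_inv_le hVN hi, Real.log_two_lt_d9]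
  have henergy : ∑ i ∈ V, τ i ^ 2 ≤ 63 * N ^ 2 * (1 + Real.log N) := by
    convert mulEnergy_intBox_le hN
    rw [Finset.mulEnergy_eq_sum_sq', Nat.cast_sum]
    simp_rw [Nat.cast_pow, τ, B, hV]
  calc ∑ p ∈ B, ∑ q ∈ B, |((p.1 * p.2 + q.1 * q.2 : ℤ) : ℝ)|⁻¹
      = ∑ i ∈ V, ∑ j ∈ V, τ i * τ j * |((i + j : ℤ) : ℝ)|⁻¹ := by
        rw [Finset.sum_congr rfl fun p _ => hfiber fun j => |((p.1 * p.2 + j : ℤ) : ℝ)|⁻¹,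
          hfiber fun i => ∑ j ∈ V, τ j * |((i + j : ℤ) : ℝ)|⁻¹]
        simp_rw [Finset.mul_sum, mul_assoc]
    _ ≤ 4 * (1 + Real.log N) * ∑ i ∈ V, τ i ^ 2 :=
        sum_sum_mul_mul_le_of_symm τ (fun _ _ => by positivity) (fun i j => by rw [add_comm]) hrow
    _ ≤ 4 * (1 + Real.log N) * (63 * N ^ 2 * (1 + Real.log N)) := by gcongr
    _ = 252 * N ^ 2 * (1 + Real.log N) ^ 2 := by ring

end Counting

/-! ### Lattice points -/

section Lattice

variable {L R : ℝ} {K K' : Plane}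

/-- The point `n / L` of the lattice of mesh `1 / L`. -/
def latticePoint (L : ℝ) (n : ℤ × ℤ) : Plane := !₂[(n.1 : ℝ) / L, (n.2 : ℝ) / L]

@[simp] lemma latticePoint_zero (L : ℝ) (n : ℤ × ℤ) : latticePoint L n 0 = n.1 / L := by
  simp [latticePoint]

@[simp] lemma latticePoint_one (L : ℝ) (n : ℤ × ℤ) : latticePoint L n 1 = n.2 / L := by
  simp [latticePoint]

lemma mem_lattice : K ∈ lattice L ↔ ∃ n, K = latticePoint L n := by
  constructor
  · rintro ⟨n, hn⟩
    refine ⟨(n 0, n 1), ?_⟩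
    ext j
    fin_cases j <;> simp [hn]
  · rintro ⟨n, rfl⟩
    refine ⟨![n.1, n.2], fun j => ?_⟩
    fin_cases j <;> simp

lemma add_mem_lattice (hK : K ∈ lattice L) (hK' : K' ∈ lattice L) : K + K' ∈ lattice L := by
  obtain ⟨n, hn⟩ := hK
  obtain ⟨m, hm⟩ := hK'
  exact ⟨n + m, fun j => by simp [hn, hm, add_div]⟩

lemma sub_mem_lattice (hK : K ∈ lattice L) (hK' : K' ∈ lattice L) : K - K' ∈ lattice L := by
  obtain ⟨n, hn⟩ := hK
  obtain ⟨m, hm⟩ := hK'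
  exact ⟨n - m, fun j => by simp [hn, hm, sub_div]⟩

lemma latticePoint_injective (hL : 0 < L) : Function.Injective (latticePoint L) := by
  intro n m h
  have h0 : latticePoint L n 0 = latticePoint L m 0 := by rw [h]
  have h1 : latticePoint L n 1 = latticePoint L m 1 := by rw [h]
  simp only [latticePoint_zero, latticePoint_one] at h0 h1
  rw [div_left_inj' hL.ne'] at h0 h1
  exact Prod.ext (by exact_mod_cast h0) (by exact_mod_cast h1)

lemma mem_intBox_of_norm_le (hL : 0 < L) {n : ℤ × ℤ} (h : ‖latticePoint L n‖ ≤ R) :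
    n ∈ intBox ⌊R * L⌋₊ ×ˢ intBox ⌊R * L⌋₊ := by
  have hcoord {a : ℤ} (ha : |(a : ℝ) / L| ≤ R) : a ∈ intBox ⌊R * L⌋₊ := by
    rw [abs_div, abs_of_pos hL, div_le_iff₀ hL] at ha
    rw [mem_intBox, ← Int.natCast_natAbs, Nat.cast_le]
    refine Nat.le_floor ?_
    rwa [Nat.cast_natAbs, Int.cast_abs]
  have h0 := (PiLp.norm_apply_le (latticePoint L n) 0).trans h
  have h1 := (PiLp.norm_apply_le (latticePoint L n) 1).trans h
  rw [Real.norm_eq_abs] at h0 h1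
  exact Finset.mem_product.2 ⟨hcoord (by simpa using h0), hcoord (by simpa using h1)⟩

open Classical in
/-- The lattice points in the closed ball of radius `R` about the origin. -/
def latticeBall (L R : ℝ) : Finset Plane :=
  ((intBox ⌊R * L⌋₊ ×ˢ intBox ⌊R * L⌋₊).image (latticePoint L)).filter fun K => ‖K‖ ≤ R

lemma mem_latticeBall (hL : 0 < L) : K ∈ latticeBall L R ↔ K ∈ lattice L ∧ ‖K‖ ≤ R := by
  rw [latticeBall, Finset.mem_filter, Finset.mem_image, mem_lattice]
  constructor
  · rintro ⟨⟨n, -, rfl⟩, h⟩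
    exact ⟨⟨n, rfl⟩, h⟩
  · rintro ⟨⟨n, rfl⟩, h⟩
    exact ⟨⟨n, mem_intBox_of_norm_le hL h, rfl⟩, h⟩

lemma card_latticeBall_le (hL : 1 ≤ L) (hR : 1 ≤ R) :
    ((latticeBall L R).card : ℝ) ≤ 9 * R ^ 2 * L ^ 2 := by
  have hcard : (latticeBall L R).card ≤ (2 * ⌊R * L⌋₊ + 1) * (2 * ⌊R * L⌋₊ + 1) := by
    refine (Finset.card_filter_le _ _).trans (Finset.card_image_le.trans ?_)
    rw [Finset.card_product, card_intBox]
  have hone : 1 ≤ R * L := one_le_mul_of_one_le_of_one_le hR hL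
  have hfloor : (⌊R * L⌋₊ : ℝ) ≤ R * L := Nat.floor_le (by linarith)
  calc ((latticeBall L R).card : ℝ)
      ≤ (2 * ⌊R * L⌋₊ + 1) * (2 * ⌊R * L⌋₊ + 1) := by exact_mod_cast hcard
    _ ≤ (3 * (R * L)) * (3 * (R * L)) := by gcongr <;> linarith
    _ = 9 * R ^ 2 * L ^ 2 := by ring

lemma one_div_le_norm (hL : 0 < L) (hK : K ∈ lattice L) (h0 : K ≠ 0) : 1 / L ≤ ‖K‖ := by
  obtain ⟨n, hn⟩ := hK
  obtain ⟨j, hj⟩ : ∃ j, n j ≠ 0 := by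
    by_contra! h
    exact h0 (by ext j; simp [hn, h])
  refine le_trans ?_ (PiLp.norm_apply_le K j)
  rw [Real.norm_eq_abs, hn, abs_div, abs_of_pos hL, ← Int.cast_abs]
  gcongr
  exact_mod_cast Int.one_le_abs hj

end Lattice

/-! ### The contribution of a single triple -/

section Triple

variable {h L R s t σ : ℝ} {K : Plane} {p : Plane × Plane × Plane}

lemma mul_sq_le_one_of_le (hL : 1 ≤ L) (hσ : 0 < σ) (ht : 0 ≤ t) (htσ : t ≤ 1 / (σ ^ 2 * L ^ 2)) :
    t * σ ^ 2 ≤ 1 := by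
  rw [le_div_iff₀ (by positivity)] at htσ
  calc t * σ ^ 2 ≤ t * (σ ^ 2 * L ^ 2) := by
        gcongr
        exact le_mul_of_one_le_right (by positivity) (one_le_pow₀ hL)
    _ ≤ 1 := htσ

lemma norm_sub_add_le_of_le {E : Type*} [SeminormedAddCommGroup E] {a b c : E} (ha : ‖a‖ ≤ R)
    (hb : ‖b‖ ≤ R) (hc : ‖c‖ ≤ R) : ‖a - b + c‖ ≤ 3 * R :=
  (norm_add_le_of_le (norm_sub_le_of_le ha hb) hc).trans_eq (by ring)

lemma packet_exponent_le_of_near {P D : ℝ} (hL : 0 < L) (hs : 0 ≤ s) (hst : s ≤ t) (hR : 0 ≤ R)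
    (hPL : 1 / L ≤ P) (hPR : P ≤ 9 * R) (hD : 0 ≤ D) (hDR : D ≤ 7 * R) :
    -P ^ 2 / (2 * σ ^ 2) + 27 * P ^ 2 * (h ^ 2 / σ ^ 4) + 72 * s * (P * D) + 216 * s * D ^ 2 ≤
      -(1 / (2 * σ ^ 2 * L ^ 2)) + 19999 * R ^ 2 * (t + h ^ 2 / σ ^ 4) := by
  have hP : 0 ≤ P := le_trans (by positivity) hPL
  have ht : 0 ≤ t := hs.trans hst
  have hmain : -P ^ 2 / (2 * σ ^ 2) ≤ -(1 / (2 * σ ^ 2 * L ^ 2)) := by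
    rw [neg_div, neg_le_neg_iff]
    calc 1 / (2 * σ ^ 2 * L ^ 2) = (1 / L) ^ 2 / (2 * σ ^ 2) := by
          rw [div_pow, one_pow, div_div, mul_comm]
      _ ≤ P ^ 2 / (2 * σ ^ 2) := by gcongr
  have hbroad : 27 * P ^ 2 * (h ^ 2 / σ ^ 4) ≤ 27 * (9 * R) ^ 2 * (h ^ 2 / σ ^ 4) := by gcongr
  have hdrift : 72 * s * (P * D) ≤ 72 * t * ((9 * R) * (7 * R)) := by gcongr
  have hdrift' : 216 * s * D ^ 2 ≤ 216 * t * (7 * R) ^ 2 := by gcongr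
  have : 0 ≤ R ^ 2 * t := by positivity
  have : 0 ≤ R ^ 2 * (h ^ 2 / σ ^ 4) := by positivity
  linarith

/-- Here the Gaussian `-P²/(2σ²)` absorbs all other terms. -/
lemma packet_exponent_le_of_far {P D : ℝ} (hL : 200 ≤ L) (hσ : 0 < σ)
    (hr : h ^ 2 / σ ^ 2 ≤ 1 / 256) (hsσ : s ≤ 1 / (σ ^ 2 * L ^ 2)) (hP : 1 ≤ P) (hD : 0 ≤ D)
    (hDP : D ≤ 4 * P) :
    -P ^ 2 / (2 * σ ^ 2) + 27 * P ^ 2 * (h ^ 2 / σ ^ 4) + 72 * s * (P * D) + 216 * s * D ^ 2 ≤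
      -(1 / (2 * σ ^ 2 * L ^ 2)) := by
  have hL2 : 40000 ≤ L ^ 2 := by nlinarith
  have hsL : s ≤ 1 / 40000 * (1 / σ ^ 2) := by
    calc s ≤ 1 / L ^ 2 * (1 / σ ^ 2) := hsσ.trans_eq (by field_simp)
      _ ≤ 1 / 40000 * (1 / σ ^ 2) := by gcongr
  have hmain : -P ^ 2 / (2 * σ ^ 2) = -(1 / 2) * (P ^ 2 * (1 / σ ^ 2)) := by field_simp
  have hbroad : 27 * P ^ 2 * (h ^ 2 / σ ^ 4) ≤ 27 * P ^ 2 * (1 / 256 * (1 / σ ^ 2)) := by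
    rw [show h ^ 2 / σ ^ 4 = h ^ 2 / σ ^ 2 * (1 / σ ^ 2) by field_simp]
    gcongr
  have hdrift : 72 * s * (P * D) ≤ 72 * (1 / 40000 * (1 / σ ^ 2)) * (P * (4 * P)) := by gcongr
  have hdrift' : 216 * s * D ^ 2 ≤ 216 * (1 / 40000 * (1 / σ ^ 2)) * (4 * P) ^ 2 := by gcongr
  have hgap : 1 / (2 * σ ^ 2 * L ^ 2) ≤ 1 / 4 * (P ^ 2 * (1 / σ ^ 2)) := by
    calc 1 / (2 * σ ^ 2 * L ^ 2) = 1 / 2 * (1 / L ^ 2) * (1 / σ ^ 2) := by field_simp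
      _ ≤ 1 / 2 * (1 / 2) * (1 / σ ^ 2) := by gcongr; linarith
      _ = 1 / 4 * (1 * (1 / σ ^ 2)) := by ring
      _ ≤ 1 / 4 * (P ^ 2 * (1 / σ ^ 2)) := by gcongr; exact one_le_pow₀ hP
  have : 0 ≤ P ^ 2 * (1 / σ ^ 2) := by positivity
  rw [hmain]
  linarith

lemma norm_packet_le_of_nonresonant (hh : 0 < h) (hL : 200 ≤ L) (hσ : 0 < σ) (hr : 16 * h ≤ σ)
    (hR : 1 ≤ R) (hs : 0 ≤ s) (hst : s ≤ t) (htσ : t ≤ 1 / (σ ^ 2 * L ^ 2)) (hp₁ : ‖p.1‖ ≤ R)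
    (hp₂ : ‖p.2.1‖ ≤ R) (hp₃ : ‖p.2.2‖ ≤ R) (hP : 1 / L ≤ ‖p.1 - p.2.1 + p.2.2 - K‖) :
    ‖packet h σ K p s‖ ≤
      2 * Real.exp (-(1 / (2 * σ ^ 2 * L ^ 2)) + 19999 * R ^ 2 * (t + h ^ 2 / σ ^ 4)) := by
  have hsσ : s * σ ^ 2 ≤ 1 := mul_sq_le_one_of_le (by linarith) hσ hs (hst.trans htσ)
  have hD : ∀ q : Plane, ‖q‖ ≤ R → ‖q - K‖ ≤ R + ‖K‖ := fun q hq =>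
    norm_sub_le_of_le hq le_rfl
  refine (norm_packet_le hh hσ hs hr hsσ (hD _ hp₁) (hD _ hp₂) (hD _ hp₃)).trans ?_
  gcongr 2 * Real.exp ?_
  have hQ := norm_sub_add_le_of_le hp₁ hp₂ hp₃
  have hupper := norm_sub_le (p.1 - p.2.1 + p.2.2) K
  have hlower := norm_sub_norm_le K (p.1 - p.2.1 + p.2.2)
  rw [norm_sub_rev] at hlower
  rcases le_total ‖K‖ (6 * R) with hK | hK
  · exact packet_exponent_le_of_near (by linarith) hs hst (by linarith) hP (by linarith)
      (by positivity) (by linarith)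
  · refine (packet_exponent_le_of_far hL hσ (ratio_sq_le hh hσ hr) (hst.trans htσ)
      (by linarith) (by positivity) (by linarith)).trans ?_
    have : 0 ≤ 19999 * R ^ 2 * (t + h ^ 2 / σ ^ 4) := by
      have := hs.trans hst
      positivity
    linarith

lemma norm_integral_packet_le (hh : 0 < h) (hL : 200 ≤ L) (hσ : 0 < σ) (hr : 16 * h ≤ σ)
    (hR : 1 ≤ R) (ht : 0 ≤ t) (htσ : t ≤ 1 / (σ ^ 2 * L ^ 2)) (hp₁ : ‖p.1‖ ≤ R)
    (hp₂ : ‖p.2.1‖ ≤ R) (hp₃ : ‖p.2.2‖ ≤ R) (hP : 1 / L ≤ ‖p.1 - p.2.1 + p.2.2 - K‖) :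
    ‖∫ s in (0 : ℝ)..t, packet h σ K p s‖ ≤
      2 * Real.exp (-(1 / (2 * σ ^ 2 * L ^ 2)) + 20000 * R ^ 2 * (t + h ^ 2 / σ ^ 4)) := by
  have hpointwise : ∀ s ∈ Set.uIoc 0 t, ‖packet h σ K p s‖ ≤
      2 * Real.exp (-(1 / (2 * σ ^ 2 * L ^ 2)) + 19999 * R ^ 2 * (t + h ^ 2 / σ ^ 4)) := by
    intro s hs
    rw [Set.uIoc_of_le ht] at hs
    exact norm_packet_le_of_nonresonant hh hL hσ hr hR hs.1.le hs.2 htσ hp₁ hp₂ hp₃ hP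
  refine (intervalIntegral.norm_integral_le_of_norm_le_const hpointwise).trans ?_
  rw [sub_zero, abs_of_nonneg ht]
  calc _ ≤ 2 * Real.exp (-(1 / (2 * σ ^ 2 * L ^ 2)) + 19999 * R ^ 2 * (t + h ^ 2 / σ ^ 4)) *
        Real.exp t := by gcongr; linarith [Real.add_one_le_exp t]
    _ = 2 * Real.exp (-(1 / (2 * σ ^ 2 * L ^ 2)) + 19999 * R ^ 2 * (t + h ^ 2 / σ ^ 4) + t) := by
      rw [mul_assoc, ← Real.exp_add]
    _ ≤ _ := by
      gcongr 2 * Real.exp ?_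
      have : 1 ≤ R ^ 2 := one_le_pow₀ hR
      have : 0 ≤ h ^ 2 / σ ^ 4 := by positivity
      nlinarith

lemma integral_packet_sub_oscillation (hh : 0 < h) (hσ : 0 < σ) (hK : K = p.1 - p.2.1 + p.2.2)
    (t : ℝ) :
    (∫ s in (0 : ℝ)..t, packet h σ K p s) - oscillation t (resonance p.1 p.2.1 p.2.2 K) =
      ∫ s in (0 : ℝ)..t, Complex.exp (-(I * s * resonance p.1 p.2.1 p.2.2 K)) *
        deviation h σ (‖p.2.1 - K‖ ^ 2) (‖p.1 - K‖ ^ 2 + ‖p.2.2 - K‖ ^ 2) s := by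
  rw [oscillation_eq_integral, ← intervalIntegral.integral_sub
    ((continuous_packet hh hσ K p).intervalIntegrable _ _)
    (Continuous.intervalIntegrable (by fun_prop) _ _)]
  refine intervalIntegral.integral_congr fun s _ => ?_
  simp only [packet_resonant hh hσ hK]
  ring

lemma c1Bound_deviation_of_le {x y : ℝ} (hh : 0 < h) (hσ : 0 < σ) (hr : 16 * h ≤ σ) (hR : 1 ≤ R)
    (htσ : t * σ ^ 2 ≤ 1) (hx : 0 ≤ x) (hy : 0 ≤ y) (hxy : x + y ≤ 48 * R ^ 2)
    (hs : s ∈ Set.Icc 0 t) :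
    C1Bound (deviation h σ x y) s
      (288 * R ^ 2 * (h ^ 2 / σ ^ 2 + t * h ^ 2 + t ^ 2 * h ^ 2))
      (1152 * R ^ 2 * (t * h ^ 2) + 60 * h ^ 2) := by
  obtain ⟨hs, hst⟩ := hs
  have ht : 0 ≤ t := hs.trans hst
  have hR2 : 1 ≤ R ^ 2 := one_le_pow₀ hR
  refine (c1Bound_deviation hh hσ hs hr (le_trans (by gcongr) htσ) hx hy).mono ?_ ?_
  · calc _ ≤ 6 * t ^ 2 * h ^ 2 * (48 * R ^ 2) + (12 * (t * h ^ 2) + 18 * (h ^ 2 / σ ^ 2)) := by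
          gcongr
      _ ≤ 6 * t ^ 2 * h ^ 2 * (48 * R ^ 2) +
          R ^ 2 * (288 * (t * h ^ 2) + 288 * (h ^ 2 / σ ^ 2)) := by
          gcongr
          refine le_trans ?_ (le_mul_of_one_le_left (by positivity) hR2)
          gcongr <;> norm_num
      _ = _ := by ring
  · calc _ ≤ 24 * t * h ^ 2 * (48 * R ^ 2) + 60 * h ^ 2 := by gcongr
      _ = _ := by ring

lemma norm_integral_packet_sub_le (hh : 0 < h) (hL : 1 ≤ L) (hσ : 0 < σ) (hr : 16 * h ≤ σ)
    (hR : 1 ≤ R) (ht : 0 ≤ t) (htσ : t ≤ 1 / (σ ^ 2 * L ^ 2)) (hp₁ : ‖p.1‖ ≤ R)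
    (hp₂ : ‖p.2.1‖ ≤ R) (hp₃ : ‖p.2.2‖ ≤ R) (hK : K = p.1 - p.2.1 + p.2.2) :
    ‖(∫ s in (0 : ℝ)..t, packet h σ K p s) - oscillation t (resonance p.1 p.2.1 p.2.2 K)‖ ≤
      2000 * R ^ 2 * (h ^ 2 / σ ^ 2 + t * h ^ 2 + t ^ 2 * h ^ 2) *
        ((if resonance p.1 p.2.1 p.2.2 K = 0 then t else 0) +
          |resonance p.1 p.2.1 p.2.2 K|⁻¹) := by
  have hD : ∀ q : Plane, ‖q‖ ≤ R → ‖q - K‖ ^ 2 ≤ 16 * R ^ 2 := fun q hq => by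
    have : ‖q - K‖ ≤ R + 3 * R :=
      norm_sub_le_of_le hq (hK ▸ norm_sub_add_le_of_le hp₁ hp₂ hp₃)
    calc ‖q - K‖ ^ 2 ≤ (R + 3 * R) ^ 2 := by gcongr
      _ = 16 * R ^ 2 := by ring
  rw [integral_packet_sub_oscillation hh hσ hK]
  generalize resonance p.1 p.2.1 p.2.2 K = ω
  have hC1 : ∀ s ∈ Set.Icc 0 t, C1Bound _ s _ _ := fun s =>
    c1Bound_deviation_of_le (x := ‖p.2.1 - K‖ ^ 2) (y := ‖p.1 - K‖ ^ 2 + ‖p.2.2 - K‖ ^ 2)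
      hh hσ hr hR (mul_sq_le_one_of_le hL hσ ht htσ) (by positivity) (by positivity)
      (by linarith [hD _ hp₁, hD _ hp₂, hD _ hp₃])
  by_cases hω : ω = 0
  · simp only [hω, Complex.ofReal_zero, mul_zero, neg_zero, Complex.exp_zero, one_mul, if_true,
      abs_zero, inv_zero, add_zero]
    refine (intervalIntegral.norm_integral_le_of_norm_le_const fun s hs =>
      (hC1 s (Set.Ioc_subset_Icc_self (Set.uIoc_of_le ht ▸ hs))).1).trans ?_
    rw [sub_zero, abs_of_nonneg ht]
    gcongr
    norm_num
  · rw [if_neg hω, zero_add]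
    refine (norm_integral_exp_mul_le hω ht (continuous_deviation hh hσ _ _) hC1).trans ?_
    rw [div_eq_mul_inv]
    gcongr
    have hR2 : 1 ≤ R ^ 2 := one_le_pow₀ hR
    have : 0 ≤ R ^ 2 * (h ^ 2 / σ ^ 2) := by positivity
    have : 0 ≤ R ^ 2 * (t ^ 2 * h ^ 2) := by positivity
    have : 0 ≤ t * h ^ 2 := by positivity
    have : t * h ^ 2 ≤ R ^ 2 * (t * h ^ 2) := le_mul_of_one_le_left (by positivity) hR2
    linarith

end Triple

/-! ### Sums over resonant triples -/

section Resonant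

variable {L R : ℝ} {K : Plane}

/-- The triples `(K₁, K₂, K₃)` with `K₁ - K₂ + K₃ = K` are the parallelograms with vertex `K`; this
is the one whose sides at `K` are the lattice vectors `q.1 / L` and `q.2 / L`. -/
def parallelogram (L : ℝ) (K : Plane) (q : (ℤ × ℤ) × (ℤ × ℤ)) : Plane × Plane × Plane :=
  (K + latticePoint L q.1, K + latticePoint L q.1 + latticePoint L q.2, K + latticePoint L q.2)

lemma parallelogram_injective (hL : 0 < L) (K : Plane) :
    Function.Injective (parallelogram L K) := by
  rintro ⟨n, m⟩ ⟨n', m'⟩ h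
  simp only [parallelogram, Prod.mk.injEq, add_right_inj] at h
  exact Prod.ext (latticePoint_injective hL h.1) (latticePoint_injective hL h.2.2)

lemma resonance_parallelogram (hL : 0 < L) (K : Plane) (q : (ℤ × ℤ) × (ℤ × ℤ)) :
    resonance (parallelogram L K q).1 (parallelogram L K q).2.1 (parallelogram L K q).2.2 K =
      -2 * ((q.1.1 * q.2.1 + q.1.2 * q.2.2 : ℤ) : ℝ) / L ^ 2 := by
  simp only [parallelogram, resonance, norm_sq_eq_sum, Fin.sum_univ_two, PiLp.add_apply,
    latticePoint_zero, latticePoint_one]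
  push_cast
  field_simp
  ring

lemma sum_ite_resonance_parallelogram (hL : 0 < L) (K : Plane) (N : ℕ) (t : ℝ) :
    ∑ q ∈ (intBox N ×ˢ intBox N) ×ˢ (intBox N ×ˢ intBox N),
      (if resonance (parallelogram L K q).1 (parallelogram L K q).2.1
        (parallelogram L K q).2.2 K = 0 then t else 0) = t * (orthPairs N).card := by
  have hzero : ∀ k : ℤ, -2 * (k : ℝ) / L ^ 2 = 0 ↔ k = 0 := fun k => by simp [hL.ne']
  simp only [resonance_parallelogram hL, hzero]
  rw [← Finset.sum_filter, Finset.sum_const, nsmul_eq_mul, mul_comm, orthPairs]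

lemma sum_abs_resonance_parallelogram_inv (hL : 0 < L) (K : Plane) (N : ℕ) :
    ∑ q ∈ (intBox N ×ˢ intBox N) ×ˢ (intBox N ×ˢ intBox N),
      |resonance (parallelogram L K q).1 (parallelogram L K q).2.1 (parallelogram L K q).2.2 K|⁻¹ =
    L ^ 2 / 2 * ∑ p ∈ intBox N ×ˢ intBox N, ∑ q ∈ intBox N ×ˢ intBox N,
      |((p.1 * p.2 + q.1 * q.2 : ℤ) : ℝ)|⁻¹ := by
  have hinv : ∀ k : ℝ, |-2 * k / L ^ 2|⁻¹ = L ^ 2 / 2 * |k|⁻¹ := fun k => by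
    rw [abs_div, abs_mul, inv_div, abs_neg, abs_two, abs_of_pos (by positivity : 0 < L ^ 2),
      div_mul_eq_div_div, div_eq_mul_inv]
  simp only [resonance_parallelogram hL, hinv]
  rw [← Finset.mul_sum]
  simp only [Finset.sum_product]
  exact congrArg _ (Finset.sum_congr rfl fun a _ => Finset.sum_comm)

open Classical in
lemma filter_latticeBall_subset_image (hL : 0 < L) (hK : K ∈ lattice L) :
    {p ∈ latticeBall L R ×ˢ latticeBall L R ×ˢ latticeBall L R | K = p.1 - p.2.1 + p.2.2} ⊆
      ((intBox ⌊4 * R * L⌋₊ ×ˢ intBox ⌊4 * R * L⌋₊) ×ˢ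
        (intBox ⌊4 * R * L⌋₊ ×ˢ intBox ⌊4 * R * L⌋₊)).image (parallelogram L K) := by
  rintro ⟨p₁, p₂, p₃⟩ hp
  simp only [Finset.mem_filter, Finset.mem_product, mem_latticeBall hL] at hp
  obtain ⟨⟨⟨hl₁, hp₁⟩, ⟨-, hp₂⟩, ⟨hl₃, hp₃⟩⟩, hKp⟩ := hp
  have hside : ∀ q : Plane, ‖q‖ ≤ R → ‖q - K‖ ≤ 4 * R := fun q hq =>
    (norm_sub_le_of_le hq (hKp ▸ norm_sub_add_le_of_le hp₁ hp₂ hp₃)).trans_eq (by ring)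
  obtain ⟨n, hn⟩ := mem_lattice.1 (sub_mem_lattice hl₁ hK)
  obtain ⟨m, hm⟩ := mem_lattice.1 (sub_mem_lattice hl₃ hK)
  refine Finset.mem_image.2 ⟨(n, m), Finset.mem_product.2
    ⟨mem_intBox_of_norm_le hL (hn ▸ hside p₁ hp₁),
      mem_intBox_of_norm_le hL (hm ▸ hside p₃ hp₃)⟩, ?_⟩
  simp only [parallelogram, ← hn, ← hm, Prod.mk.injEq]
  refine ⟨by abel, ?_, by abel⟩
  rw [hKp]
  abel

lemma one_le_log (hL : 3 ≤ L) : 1 ≤ Real.log L := by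
  rw [Real.le_log_iff_exp_le (by linarith)]
  linarith [Real.exp_one_lt_three]

lemma one_add_log_floor_le (hL : 3 ≤ L) (hR : 1 ≤ R) :
    1 + Real.log ⌊4 * R * L⌋₊ ≤ (2 + Real.log (4 * R)) * Real.log L := by
  have hN : 1 ≤ ⌊4 * R * L⌋₊ := Nat.le_floor (by norm_num; nlinarith)
  have hlog : Real.log ⌊4 * R * L⌋₊ ≤ Real.log (4 * R) + Real.log L := by
    rw [← Real.log_mul (by positivity) (by positivity)]
    exact Real.log_le_log (by exact_mod_cast hN) (Nat.floor_le (by positivity))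
  have hlogR : 0 ≤ Real.log (4 * R) := Real.log_nonneg (by linarith)
  nlinarith [one_le_log hL]

open Classical in
lemma sum_resonant_le {t : ℝ} (hL : 3 ≤ L) (hR : 1 ≤ R) (ht : 0 ≤ t) (hK : K ∈ lattice L) :
    ∑ p ∈ latticeBall L R ×ˢ latticeBall L R ×ˢ latticeBall L R with K = p.1 - p.2.1 + p.2.2,
      ((if resonance p.1 p.2.1 p.2.2 K = 0 then t else 0) +
        |resonance p.1 p.2.1 p.2.2 K|⁻¹) ≤
      2016 * R ^ 2 * (2 + Real.log (4 * R)) ^ 2 *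
        (t * L ^ 2 * Real.log L + L ^ 4 * Real.log L ^ 2) := by
  have hL0 : 0 < L := by linarith
  have hlogL : 0 ≤ Real.log L := zero_le_one.trans (one_le_log hL)
  refine (Finset.sum_le_sum_of_subset_of_nonneg (filter_latticeBall_subset_image hL0 hK)
    fun p _ _ => by split_ifs <;> positivity).trans ?_
  rw [Finset.sum_image (parallelogram_injective hL0 K).injOn, Finset.sum_add_distrib,
    sum_ite_resonance_parallelogram hL0, sum_abs_resonance_parallelogram_inv hL0]
  have hlogN := one_add_log_floor_le hL hR
  have hN : 1 ≤ ⌊4 * R * L⌋₊ := Nat.le_floor (by norm_num; nlinarith)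
  have hNL : (⌊4 * R * L⌋₊ : ℝ) ≤ 4 * R * L := Nat.floor_le (by positivity)
  have hcount := card_orthPairs_le hN
  have hsum := sum_sum_abs_inv_le hN
  have : 0 ≤ Real.log ⌊4 * R * L⌋₊ := Real.log_natCast_nonneg _
  set c := 2 + Real.log (4 * R)
  have hc : 1 ≤ c := by linarith [Real.log_nonneg (show 1 ≤ 4 * R by linarith)]
  calc _ ≤ t * (63 * (4 * R * L) ^ 2 * (c * Real.log L)) +
        L ^ 2 / 2 * (252 * (4 * R * L) ^ 2 * (c * Real.log L) ^ 2) := by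
        gcongr
        · exact hcount.trans (by gcongr)
        · exact hsum.trans (by gcongr)
    _ = R ^ 2 * (1008 * c * (t * L ^ 2 * Real.log L) +
          2016 * c ^ 2 * (L ^ 4 * Real.log L ^ 2)) := by ring
    _ ≤ R ^ 2 * (2016 * c ^ 2 * (t * L ^ 2 * Real.log L) +
          2016 * c ^ 2 * (L ^ 4 * Real.log L ^ 2)) := by
        gcongr
        · norm_num
        · exact le_self_pow₀ hc two_ne_zero
    _ = _ := by ring

end Resonant

/-! ### The remainder at fixed parameters -/

/-- The difference between the coarse grained cubic term and the discrete interaction sum. -/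
def remainder (η : Plane → ℂ) (h L σ : ℝ) (K : Plane) (t : ℝ) : ℂ :=
  coarse (firstOrder (initialDatum η h L) t) K σ -
    (1 / (2 * (Real.pi : ℂ)) ^ 4) * interactionSum η L K t

open Classical in
/-- The error made in replacing the contribution of the triple `p` to the coarse grained cubic term
by its contribution to the discrete interaction sum, which is zero unless `K = K₁ - K₂ + K₃`. -/
def tripleError (h σ : ℝ) (K : Plane) (t : ℝ) (p : Plane × Plane × Plane) : ℂ :=
  (∫ s in (0 : ℝ)..t, packet h σ K p s) -
    if K = p.1 - p.2.1 + p.2.2 then oscillation t (resonance p.1 p.2.1 p.2.2 K) else 0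

section FixedParameters

variable {h L M R t σ : ℝ} {K : Plane}

lemma remainder_eq_sum {η : Plane → ℂ} {S : Finset Plane} (hS : ∀ K ∈ S, K ∈ lattice L)
    (hη : ∀ K ∈ lattice L, K ∉ S → η K = 0) (hh : 0 < h) (hσ : 0 < σ) (ht : 0 ≤ t) (K : Plane) :
    remainder η h L σ K t = (1 / (2 * (π : ℂ)) ^ 4) *
      ∑ p ∈ S ×ˢ S ×ˢ S, η p.1 * (starRingEnd ℂ) (η p.2.1) * η p.2.2 * tripleError h σ K t p := by
  rw [remainder, coarse_firstOrder hS hη hh hσ ht K, interactionSum_eq_sum hS hη K t, ← mul_sub,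
    ← Finset.sum_sub_distrib]
  simp only [tripleError, mul_sub]

lemma norm_remainder_le_sum {η : Plane → ℂ} (hM : ∀ K, ‖η K‖ ≤ M) {S : Finset Plane}
    (hS : ∀ K ∈ S, K ∈ lattice L) (hη : ∀ K ∈ lattice L, K ∉ S → η K = 0) (hh : 0 < h)
    (hσ : 0 < σ) (ht : 0 ≤ t) (K : Plane) :
    ‖remainder η h L σ K t‖ ≤ M ^ 3 * ∑ p ∈ S ×ˢ S ×ˢ S, ‖tripleError h σ K t p‖ := by
  have hM0 : 0 ≤ M := (norm_nonneg _).trans (hM 0)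
  have hπ : ‖(1 / (2 * (π : ℂ)) ^ 4)‖ ≤ 1 := by
    rw [norm_div, norm_one, norm_pow, norm_mul, Complex.norm_ofNat, Complex.norm_real,
      Real.norm_of_nonneg Real.pi_pos.le]
    refine div_le_one_of_le₀ (one_le_pow₀ ?_) (by positivity)
    linarith [Real.pi_gt_three]
  rw [remainder_eq_sum hS hη hh hσ ht K, norm_mul, Finset.mul_sum]
  refine (mul_le_of_le_one_left (norm_nonneg _) hπ).trans (norm_sum_le_of_le _ fun p _ => ?_)
  rw [norm_mul, norm_mul, norm_mul, RCLike.norm_conj]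
  calc _ ≤ M * M * M * ‖tripleError h σ K t p‖ := by gcongr <;> exact hM _
    _ = _ := by ring

open Classical in
lemma sum_norm_tripleError_nonresonant_le (hh : 0 < h) (hL : 200 ≤ L) (hσ : 0 < σ)
    (hr : 16 * h ≤ σ) (hR : 1 ≤ R) (ht : 0 ≤ t) (htσ : t ≤ 1 / (σ ^ 2 * L ^ 2))
    (hK : K ∈ lattice L) :
    ∑ p ∈ latticeBall L R ×ˢ latticeBall L R ×ˢ latticeBall L R with ¬ K = p.1 - p.2.1 + p.2.2,
      ‖tripleError h σ K t p‖ ≤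
    1458 * R ^ 6 * (L ^ 6 * Real.exp (-(1 / (2 * σ ^ 2 * L ^ 2)) +
      20000 * R ^ 2 * (t + h ^ 2 / σ ^ 4))) := by
  have hL0 : 0 < L := by linarith
  set e := Real.exp (-(1 / (2 * σ ^ 2 * L ^ 2)) + 20000 * R ^ 2 * (t + h ^ 2 / σ ^ 4))
  set T := {p ∈ latticeBall L R ×ˢ latticeBall L R ×ˢ latticeBall L R | ¬ K = p.1 - p.2.1 + p.2.2}
  have hterm : ∀ p ∈ T, ‖tripleError h σ K t p‖ ≤ 2 * e := by
    intro p hp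
    simp only [T, Finset.mem_filter, Finset.mem_product, mem_latticeBall hL0] at hp
    obtain ⟨⟨⟨hl₁, hp₁⟩, ⟨hl₂, hp₂⟩, ⟨hl₃, hp₃⟩⟩, hpK⟩ := hp
    rw [tripleError, if_neg hpK, sub_zero]
    refine norm_integral_packet_le hh hL hσ hr hR ht htσ hp₁ hp₂ hp₃ (one_div_le_norm hL0 ?_ ?_)
    · exact sub_mem_lattice (add_mem_lattice (sub_mem_lattice hl₁ hl₂) hl₃) hK
    · exact fun h0 => hpK (sub_eq_zero.1 h0).symm
  have hcard : (T.card : ℝ) ≤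
      (latticeBall L R).card * ((latticeBall L R).card * (latticeBall L R).card) := by
    exact_mod_cast (Finset.card_filter_le _ _).trans_eq (by simp only [Finset.card_product])
  have hball := card_latticeBall_le (by linarith : 1 ≤ L) hR
  calc _ ≤ T.card * (2 * e) := by
          simpa only [nsmul_eq_mul] using Finset.sum_le_card_nsmul T _ _ hterm
    _ ≤ (9 * R ^ 2 * L ^ 2) * ((9 * R ^ 2 * L ^ 2) * (9 * R ^ 2 * L ^ 2)) * (2 * e) := by
      gcongr
      exact hcard.trans (by gcongr)
    _ = 1458 * R ^ 6 * (L ^ 6 * e) := by ring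

open Classical in
lemma sum_norm_tripleError_resonant_le (hh : 0 < h) (hL : 3 ≤ L) (hσ : 0 < σ) (hr : 16 * h ≤ σ)
    (hR : 1 ≤ R) (ht : 0 ≤ t) (htσ : t ≤ 1 / (σ ^ 2 * L ^ 2)) (hK : K ∈ lattice L) :
    ∑ p ∈ latticeBall L R ×ˢ latticeBall L R ×ˢ latticeBall L R with K = p.1 - p.2.1 + p.2.2,
      ‖tripleError h σ K t p‖ ≤
    4032000 * R ^ 4 * (2 + Real.log (4 * R)) ^ 2 *
      ((h ^ 2 / σ ^ 2 + t * h ^ 2 + t ^ 2 * h ^ 2) *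
        (t * L ^ 2 * Real.log L + L ^ 4 * Real.log L ^ 2)) := by
  calc _ ≤ ∑ p ∈ latticeBall L R ×ˢ latticeBall L R ×ˢ latticeBall L R with
          K = p.1 - p.2.1 + p.2.2,
        2000 * R ^ 2 * (h ^ 2 / σ ^ 2 + t * h ^ 2 + t ^ 2 * h ^ 2) *
          ((if resonance p.1 p.2.1 p.2.2 K = 0 then t else 0) +
            |resonance p.1 p.2.1 p.2.2 K|⁻¹) := by
        refine Finset.sum_le_sum fun p hp => ?_
        simp only [Finset.mem_filter, Finset.mem_product,
          mem_latticeBall (by linarith : 0 < L)] at hp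
        obtain ⟨⟨⟨-, hp₁⟩, ⟨-, hp₂⟩, ⟨-, hp₃⟩⟩, hpK⟩ := hp
        rw [tripleError, if_pos hpK]
        exact norm_integral_packet_sub_le hh (by linarith) hσ hr hR ht htσ hp₁ hp₂ hp₃ hpK
    _ ≤ 2000 * R ^ 2 * (h ^ 2 / σ ^ 2 + t * h ^ 2 + t ^ 2 * h ^ 2) *
        (2016 * R ^ 2 * (2 + Real.log (4 * R)) ^ 2 *
          (t * L ^ 2 * Real.log L + L ^ 4 * Real.log L ^ 2)) := by
        rw [← Finset.mul_sum]
        gcongr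
        exact sum_resonant_le hL hR ht hK
    _ = _ := by ring

end FixedParameters

/-- The estimate of the remainder at fixed parameters, with a constant `C` meant to depend on
`η` only, from which both the explicit bound and the asymptotic one follow. -/
def RemainderBound (η : Plane → ℂ) (C : ℝ) : Prop :=
  ∀ ⦃h L σ t : ℝ⦄ ⦃K : Plane⦄, 0 < h → 200 ≤ L → 0 < σ → 16 * h ≤ σ → 0 ≤ t →
    t ≤ 1 / (σ ^ 2 * L ^ 2) → K ∈ lattice L →
    ‖remainder η h L σ K t‖ ≤
      C * L ^ 6 * Real.exp (-(1 / (2 * σ ^ 2 * L ^ 2)) + C * (t + h ^ 2 / σ ^ 4)) +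
      C * (h ^ 2 / σ ^ 2 + t * h ^ 2 + t ^ 2 * h ^ 2) *
        (t * L ^ 2 * Real.log L + L ^ 4 * Real.log L ^ 2)

lemma exists_remainderBound {η : Plane → ℂ} {M R : ℝ} (hM : ∀ K, ‖η K‖ ≤ M) (hR : 1 ≤ R)
    (hη : ∀ K, η K ≠ 0 → ‖K‖ ≤ R) : ∃ C, 0 < C ∧ RemainderBound η C := by
  classical
  have hM0 : 0 ≤ M := (norm_nonneg _).trans (hM 0)
  set a := M ^ 3 * (1458 * R ^ 6) with ha
  set b := M ^ 3 * (4032000 * R ^ 4 * (2 + Real.log (4 * R)) ^ 2) with hb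
  have ha0 : 0 ≤ a := by positivity
  have hb0 : 0 ≤ b := by positivity
  refine ⟨a + b + 20000 * R ^ 2, by positivity, ?_⟩
  intro h L σ t K hh hL hσ hr ht htσ hK
  have hL0 : 0 < L := by linarith
  have hlog : 0 ≤ Real.log L := Real.log_nonneg (by linarith)
  have hball : ∀ K ∈ lattice L, K ∉ latticeBall L R → η K = 0 := fun K hl hK => by
    by_contra hne
    exact hK ((mem_latticeBall hL0).2 ⟨hl, hη K hne⟩)
  have hnonres := sum_norm_tripleError_nonresonant_le hh hL hσ hr hR ht htσ hK
  have hres := sum_norm_tripleError_resonant_le hh (by linarith) hσ hr hR ht htσ hK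
  have hsum := norm_remainder_le_sum hM (fun K hK => ((mem_latticeBall hL0).1 hK).1) hball
    hh hσ ht K
  rw [← Finset.sum_filter_not_add_sum_filter _ fun p => K = p.1 - p.2.1 + p.2.2] at hsum
  calc ‖remainder η h L σ K t‖
      ≤ M ^ 3 * (1458 * R ^ 6 * (L ^ 6 * Real.exp (-(1 / (2 * σ ^ 2 * L ^ 2)) +
          20000 * R ^ 2 * (t + h ^ 2 / σ ^ 4))) +
        4032000 * R ^ 4 * (2 + Real.log (4 * R)) ^ 2 *
          ((h ^ 2 / σ ^ 2 + t * h ^ 2 + t ^ 2 * h ^ 2) *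
            (t * L ^ 2 * Real.log L + L ^ 4 * Real.log L ^ 2))) :=
        hsum.trans (by gcongr)
    _ = a * L ^ 6 * Real.exp (-(1 / (2 * σ ^ 2 * L ^ 2)) + 20000 * R ^ 2 * (t + h ^ 2 / σ ^ 4)) +
        b * (h ^ 2 / σ ^ 2 + t * h ^ 2 + t ^ 2 * h ^ 2) *
          (t * L ^ 2 * Real.log L + L ^ 4 * Real.log L ^ 2) := by rw [ha, hb]; ring
    _ ≤ _ := by gcongr <;> linarith [show 0 ≤ 20000 * R ^ 2 by positivity]

/-! ### The asymptotic regime -/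

lemma AsymptoticRegime.eventually {ι : Type*} {l : Filter ι} {h L σ : ι → ℝ}
    (H : AsymptoticRegime l h L σ) {ε A : ℝ} (hε : 0 < ε) :
    ∀ᶠ i in l, 0 < h i ∧ 0 < σ i ∧ A ≤ L i ∧ 1 ≤ L i ∧ h i * L i ≤ ε * σ i ∧
      h i * L i ^ 4 ≤ 1 ∧ σ i ^ 2 * L i ^ 2 ≤ h i := by
  obtain ⟨δ₀, hδ₀, htr⟩ := H.truncation
  filter_upwards [H.pos, H.large.eventually_ge_atTop A, H.large.eventually_ge_atTop 1, htr,
    H.lower.bound hε, H.upper] with i ⟨hh, hL, hσ⟩ hA h1 htr hlow hup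
  rw [Real.norm_of_nonneg (by positivity), Real.norm_of_nonneg hσ.le] at hlow
  have hhL : h i * L i ^ 4 ≤ 1 := by
    refine le_trans ?_ htr
    gcongr
    rw [← Real.rpow_natCast (L i) 4]
    exact Real.rpow_le_rpow_of_exponent_le h1 (by push_cast; linarith)
  have hσ4 : σ i ^ 4 ≤ h i ^ 3 := by
    calc σ i ^ 4 ≤ (h i ^ (3 / 4 : ℝ)) ^ 4 := by gcongr
      _ = h i ^ 3 := by
        rw [← Real.rpow_natCast, ← Real.rpow_mul hh.le, ← Real.rpow_natCast (h i) 3]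
        norm_num
  refine ⟨hh, hσ, hA, h1, hlow, hhL, le_of_sq_le_sq ?_ hh.le⟩
  calc (σ i ^ 2 * L i ^ 2) ^ 2 = σ i ^ 4 * L i ^ 4 := by ring
    _ ≤ h i ^ 3 * L i ^ 4 := by gcongr
    _ = h i ^ 2 * (h i * L i ^ 4) := by ring
    _ ≤ h i ^ 2 := mul_le_of_le_one_right (by positivity) hhL

lemma pow_four_mul_log_sq_le_rpow {δ L : ℝ} (hδ : 0 < δ) (hL : 1 ≤ L) :
    L ^ 4 * Real.log L ^ 2 ≤ (2 / δ) ^ 2 * L ^ (4 + δ) := by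
  have hlog := Real.log_le_rpow_div (x := L) (by linarith) (half_pos hδ)
  have hlog0 : 0 ≤ Real.log L := Real.log_nonneg hL
  calc L ^ 4 * Real.log L ^ 2 ≤ L ^ 4 * (L ^ (δ / 2) / (δ / 2)) ^ 2 := by gcongr
    _ = (2 / δ) ^ 2 * (L ^ 4 * (L ^ (δ / 2) * L ^ (δ / 2))) := by field_simp
    _ = (2 / δ) ^ 2 * L ^ (4 + δ) := by
      rw [← Real.rpow_add (by linarith), add_halves, Real.rpow_add (by linarith), Real.rpow_ofNat]

lemma RemainderBound.eventually_le {η : Plane → ℂ} {C : ℝ} (hbound : RemainderBound η C)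
    (hC : 0 < C) {δ : ℝ} (hδ : 0 < δ) {ι : Type*} {l : Filter ι} {h L σ : ι → ℝ}
    (H : AsymptoticRegime l h L σ) :
    ∀ᶠ i in l, ∀ K ∈ lattice (L i), ∀ t : ℝ, 0 ≤ t → t ≤ 1 / (σ i ^ 2 * L i ^ 2) →
      ‖remainder η (h i) (L i) (σ i) K t‖ ≤
        C * L i ^ 6 *
            Real.exp (-(1 / (2 * σ i ^ 2 * L i ^ 2)) + C * (t + h i ^ 2 / σ i ^ 4))
          + C * t * L i ^ 2 * Real.log (L i) *
            (h i ^ 2 / σ i ^ 2 + t * σ i ^ 2 + t ^ 2 * h i ^ 2 + t ^ 3 * σ i ^ 4)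
          + C * (2 / δ) ^ 2 * L i ^ (4 + δ) *
            (h i ^ 2 / σ i ^ 2 + t * σ i ^ 2 + t ^ 2 * σ i ^ 2 + t ^ 3 * σ i ^ 4) := by
  filter_upwards [H.eventually (A := 200) one_pos] with i
    ⟨hh, hσ, hL, hL1, hlow, _, _⟩ K hK t ht htσ
  have hr : 16 * h i ≤ σ i := by nlinarith
  have hhσ : h i ^ 2 ≤ σ i ^ 2 := by gcongr; linarith
  have hlog : 0 ≤ Real.log (L i) := Real.log_nonneg hL1
  have hσ4 : 0 ≤ t ^ 3 * σ i ^ 4 := by positivity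
  have hE : h i ^ 2 / σ i ^ 2 + t * h i ^ 2 + t ^ 2 * h i ^ 2 ≤
      h i ^ 2 / σ i ^ 2 + t * σ i ^ 2 + t ^ 2 * h i ^ 2 + t ^ 3 * σ i ^ 4 :=
    le_add_of_le_of_nonneg (by gcongr) hσ4
  have hE' : h i ^ 2 / σ i ^ 2 + t * h i ^ 2 + t ^ 2 * h i ^ 2 ≤
      h i ^ 2 / σ i ^ 2 + t * σ i ^ 2 + t ^ 2 * σ i ^ 2 + t ^ 3 * σ i ^ 4 :=
    le_add_of_le_of_nonneg (by gcongr) hσ4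
  have hpow := pow_four_mul_log_sq_le_rpow hδ hL1
  refine (hbound hh hL hσ hr ht htσ hK).trans ?_
  rw [mul_add (C * (_ + _)), ← add_assoc]
  refine add_le_add (add_le_add le_rfl ?_) ?_
  · calc _ = C * t * L i ^ 2 * Real.log (L i) *
          (h i ^ 2 / σ i ^ 2 + t * h i ^ 2 + t ^ 2 * h i ^ 2) := by ring
      _ ≤ _ := by gcongr
  · calc _ ≤ C * (h i ^ 2 / σ i ^ 2 + t * σ i ^ 2 + t ^ 2 * σ i ^ 2 + t ^ 3 * σ i ^ 4) *
          ((2 / δ) ^ 2 * L i ^ (4 + δ)) := by gcongr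
      _ = _ := by ring

section SmallParameters

variable {C h L t ε σ : ℝ}

lemma sq_div_sq_le_of_mul_le (hh : 0 ≤ h) (hL : 0 < L) (hσ : 0 < σ) (hlow : h * L ≤ ε * σ) :
    h ^ 2 / σ ^ 2 ≤ ε ^ 2 / L ^ 2 := by
  rw [← div_pow, ← div_pow]
  exact pow_le_pow_left₀ (by positivity) ((div_le_div_iff₀ hσ hL).2 hlow) 2

lemma exponential_error_le (hC : 0 < C) (hh : 0 < h) (hL : 1 ≤ L) (hσ : 0 < σ) (hε : 0 < ε)
    (hε1 : ε ≤ 1) (hCε : 8 * (C * ε) ≤ 1) (hεL : 1 ≤ ε * L) (hlow : h * L ≤ ε * σ)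
    (hhL : h * L ^ 4 ≤ 1) (hσh : σ ^ 2 * L ^ 2 ≤ h) (hth : t * h ≤ ε) :
    C * L ^ 6 * Real.exp (-(1 / (2 * σ ^ 2 * L ^ 2)) + C * (t + h ^ 2 / σ ^ 4)) ≤
      4 * C * ε * L ^ 4 := by
  have hL0 : 0 < L := by linarith
  set Y := 1 / (σ ^ 2 * L ^ 2) with hY
  have hinv : 1 / h ≤ Y := one_div_le_one_div_of_le (by positivity) hσh
  have hY4 : L ^ 4 ≤ Y := (by rwa [le_div_iff₀' hh] : L ^ 4 ≤ 1 / h).trans hinv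
  have htY : t ≤ ε * Y := by
    calc t ≤ ε * (1 / h) := by rwa [mul_one_div, le_div_iff₀ hh]
      _ ≤ ε * Y := by gcongr
  have hσY : h ^ 2 / σ ^ 4 ≤ ε * Y := by
    calc h ^ 2 / σ ^ 4 = h ^ 2 / σ ^ 2 * (1 / σ ^ 2) := by field_simp
      _ ≤ ε ^ 2 / L ^ 2 * (1 / σ ^ 2) := mul_le_mul_of_nonneg_right
          (sq_div_sq_le_of_mul_le hh.le hL0 hσ hlow) (by positivity)
      _ = ε ^ 2 * Y := by rw [hY]; field_simp
      _ ≤ ε * Y := by gcongr; exact pow_le_of_le_one hε.le hε1 two_ne_zero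
  have hexponent : -(1 / (2 * σ ^ 2 * L ^ 2)) + C * (t + h ^ 2 / σ ^ 4) ≤ -(Y / 4) := by
    calc _ ≤ -(Y / 2) + C * (ε * Y + ε * Y) := by
          rw [show 1 / (2 * σ ^ 2 * L ^ 2) = Y / 2 by rw [hY]; field_simp]
          gcongr
      _ = -(Y / 2) + 8 * (C * ε) * (Y / 4) := by ring
      _ ≤ -(Y / 2) + 1 * (Y / 4) := by gcongr
      _ = -(Y / 4) := by ring
  have hexp : Real.exp (-(Y / 4)) ≤ 4 / L ^ 4 := by
    rw [Real.exp_neg, inv_le_comm₀ (Real.exp_pos _) (by positivity), inv_div]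
    linarith [Real.add_one_le_exp (Y / 4)]
  calc _ ≤ C * L ^ 6 * (4 / L ^ 4) := by
        gcongr
        exact (Real.exp_le_exp.2 hexponent).trans hexp
    _ = 4 * C * L * (1 * L) := by field_simp
    _ ≤ 4 * C * L * (ε * L * L) := by gcongr
    _ = 4 * C * ε * L ^ 3 := by ring
    _ ≤ 4 * C * ε * L ^ 4 := by gcongr; norm_num

lemma polynomial_factor_le (hh : 0 < h) (hL : 1 ≤ L) (hσ : 0 < σ) (ht : 0 ≤ t) (hε : 0 < ε)
    (hε1 : ε ≤ 1) (hlow : h * L ≤ ε * σ) (hh1 : h ≤ 1) (hth : t * h ≤ ε) :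
    h ^ 2 / σ ^ 2 + t * h ^ 2 + t ^ 2 * h ^ 2 ≤ 3 * ε := by
  have hsq : ε ^ 2 ≤ ε := pow_le_of_le_one hε.le hε1 two_ne_zero
  have hfirst : h ^ 2 / σ ^ 2 ≤ ε :=
    (sq_div_sq_le_of_mul_le hh.le (by linarith) hσ hlow).trans
      ((div_le_self (sq_nonneg ε) (one_le_pow₀ hL)).trans hsq)
  have hsecond : t * h ^ 2 ≤ ε := by
    calc t * h ^ 2 = t * h * h := by ring
      _ ≤ ε * 1 := by gcongr
      _ = ε := mul_one ε
  have hthird : t ^ 2 * h ^ 2 ≤ ε := by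
    calc t ^ 2 * h ^ 2 = (t * h) ^ 2 := by ring
      _ ≤ ε ^ 2 := by gcongr
      _ ≤ ε := hsq
  linarith

lemma polynomial_error_le (hh : 0 < h) (hL : 1 ≤ L) (hσ : 0 < σ) (ht : 0 ≤ t) (hε : 0 < ε)
    (hε1 : ε ≤ 1) (hlow : h * L ≤ ε * σ) (hhL : h * L ^ 4 ≤ 1) (hth : t * h ≤ ε) :
    (h ^ 2 / σ ^ 2 + t * h ^ 2 + t ^ 2 * h ^ 2) *
        (t * L ^ 2 * Real.log L + L ^ 4 * Real.log L ^ 2) ≤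
      4 * ε * (t * L ^ 2 * Real.log L + L ^ 4) := by
  have hL0 : 0 < L := by linarith
  have hlog : 0 ≤ Real.log L := Real.log_nonneg hL
  have hlogL : Real.log L ≤ L := Real.log_le_self hL0.le
  have hhpow : ∀ n ≤ 4, h * L ^ n ≤ 1 := fun n hn => by
    calc h * L ^ n ≤ h * L ^ 4 := by gcongr
      _ ≤ 1 := hhL
  have hfactor := polynomial_factor_le hh hL hσ ht hε hε1 hlow
    (by simpa only [pow_zero, mul_one] using hhpow 0 (by norm_num)) hth
  have hfirst : h ^ 2 / σ ^ 2 * (L ^ 4 * Real.log L ^ 2) ≤ ε * L ^ 4 := by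
    have hhσ := sq_div_sq_le_of_mul_le hh.le hL0 hσ hlow
    calc _ ≤ ε ^ 2 / L ^ 2 * (L ^ 4 * L ^ 2) := by gcongr
      _ = ε ^ 2 * L ^ 4 := by field_simp
      _ ≤ ε * L ^ 4 := by gcongr; exact pow_le_of_le_one hε.le hε1 two_ne_zero
  have hsecond : t * h ^ 2 * (L ^ 4 * Real.log L ^ 2) ≤ ε * L ^ 4 := by
    calc _ = t * h * h * (L ^ 4 * Real.log L ^ 2) := by ring
      _ ≤ ε * h * (L ^ 4 * L ^ 2) := by gcongr
      _ = ε * (h * L ^ 2) * L ^ 4 := by ring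
      _ ≤ ε * 1 * L ^ 4 := by gcongr; exact hhpow 2 (by norm_num)
      _ = ε * L ^ 4 := by rw [mul_one]
  have hthird : t ^ 2 * h ^ 2 * (L ^ 4 * Real.log L ^ 2) ≤ ε * (t * L ^ 2 * Real.log L) := by
    calc _ = t * h * (h * L ^ 2 * Real.log L) * (t * L ^ 2 * Real.log L) := by ring
      _ ≤ ε * (h * L ^ 2 * L) * (t * L ^ 2 * Real.log L) := by gcongr
      _ = ε * (h * L ^ 3) * (t * L ^ 2 * Real.log L) := by ring
      _ ≤ ε * 1 * (t * L ^ 2 * Real.log L) := by gcongr; exact hhpow 3 (by norm_num)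
      _ = ε * (t * L ^ 2 * Real.log L) := by rw [mul_one]
  calc _ = (h ^ 2 / σ ^ 2 + t * h ^ 2 + t ^ 2 * h ^ 2) * (t * L ^ 2 * Real.log L) +
        (h ^ 2 / σ ^ 2 * (L ^ 4 * Real.log L ^ 2) + t * h ^ 2 * (L ^ 4 * Real.log L ^ 2) +
          t ^ 2 * h ^ 2 * (L ^ 4 * Real.log L ^ 2)) := by ring
    _ ≤ 3 * ε * (t * L ^ 2 * Real.log L) +
        (ε * L ^ 4 + ε * L ^ 4 + ε * (t * L ^ 2 * Real.log L)) := by gcongr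
    _ ≤ _ := by linarith [show 0 ≤ ε * L ^ 4 by positivity]

lemma RemainderBound.norm_le {η : Plane → ℂ} {K : Plane} (hbound : RemainderBound η C)
    (hC : 0 < C) (hh : 0 < h) (hL : 200 ≤ L) (hσ : 0 < σ) (ht : 0 ≤ t) (hε : 0 < ε) (hε1 : ε ≤ 1)
    (hCε : 8 * (C * ε) ≤ 1) (hεL : 1 ≤ ε * L) (hlow : h * L ≤ ε * σ) (hhL : h * L ^ 4 ≤ 1)
    (hσh : σ ^ 2 * L ^ 2 ≤ h) (hth : t * h ≤ ε) (hK : K ∈ lattice L) :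
    ‖remainder η h L σ K t‖ ≤ 8 * C * ε * (t * L ^ 2 * Real.log L + L ^ 4) := by
  have hL1 : 1 ≤ L := by linarith
  have hlog : 0 ≤ Real.log L := Real.log_nonneg hL1
  have hr : 16 * h ≤ σ := by
    calc 16 * h ≤ h * L := by rw [mul_comm]; gcongr; linarith
      _ ≤ 1 * σ := hlow.trans (by gcongr)
      _ = σ := one_mul σ
  have htσ : t ≤ 1 / (σ ^ 2 * L ^ 2) := by
    rw [le_div_iff₀ (by positivity)]
    calc t * (σ ^ 2 * L ^ 2) ≤ t * h := by gcongr
      _ ≤ 1 := hth.trans hε1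
  have hpoly := polynomial_error_le hh hL1 hσ ht hε hε1 hlow hhL hth
  calc _ ≤ _ := hbound hh hL hσ hr ht htσ hK
    _ ≤ 4 * C * ε * L ^ 4 + C * (4 * ε * (t * L ^ 2 * Real.log L + L ^ 4)) := by
      rw [mul_assoc C (_ + _)]
      exact add_le_add (exponential_error_le hC hh hL1 hσ hε hε1 hCε hεL hlow hhL hσh hth)
        (mul_le_mul_of_nonneg_left hpoly hC.le)
    _ ≤ _ := by linarith [show 0 ≤ C * ε * (t * L ^ 2 * Real.log L) by positivity]

end SmallParameters

lemma RemainderBound.isLittleO {η : Plane → ℂ} {C : ℝ} (hbound : RemainderBound η C) (hC : 0 < C)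
    {ι : Type*} {l : Filter ι} {h L σ t : ι → ℝ} {K : ι → Plane}
    (H : AsymptoticRegime l h L σ) (hK : ∀ᶠ i in l, K i ∈ lattice (L i))
    (ht : ∀ᶠ i in l, 0 ≤ t i) (hth : t =o[l] fun i => 1 / h i) :
    (fun i => remainder η (h i) (L i) (σ i) (K i) (t i)) =o[l]
      fun i => t i * L i ^ 2 * Real.log (L i) + L i ^ 4 := by
  rw [isLittleO_iff]
  intro c hc
  obtain ⟨ε, hε, hεle⟩ := exists_between (show 0 < min 1 (min 1 c / (8 * C)) by positivity)
  have hCε : 8 * C * ε ≤ min 1 c := by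
    rw [mul_comm, ← le_div_iff₀ (by positivity)]
    exact hεle.le.trans (min_le_right _ _)
  filter_upwards [H.eventually (A := max 200 (1 / ε)) hε, hK, ht, hth.bound hε] with i
    ⟨hh, hσ, hA, hL, hlow, hhL, hσh⟩ hK ht hth
  rw [Real.norm_of_nonneg ht, Real.norm_of_nonneg (by positivity), mul_one_div,
    le_div_iff₀ hh] at hth
  have hεL : 1 ≤ ε * L i := by
    rw [← div_le_iff₀' hε]
    exact (le_max_right _ _).trans hA
  have hlog : 0 ≤ Real.log (L i) := Real.log_nonneg hL
  refine (hbound.norm_le hC hh ((le_max_left _ _).trans hA) hσ ht hε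
    (hεle.le.trans (min_le_left _ _)) ?_ hεL hlow hhL hσh hth hK).trans ?_
  · rw [← mul_assoc]
    exact hCε.trans (min_le_left _ _)
  · rw [Real.norm_of_nonneg (by positivity)]
    gcongr
    exact hCε.trans (min_le_right _ _)

end

end CoarseNLS

theorem proposition4p3_general (η : CoarseNLS.Plane → ℂ) (hη : Bornology.IsBounded (Set.range η))
    (hsupp : Bornology.IsBounded (Function.support η)) :
    ∃ r : (h L σ : ℝ) → (K : CoarseNLS.Plane) → (t : ℝ) → ℂ,
      (∀ h L σ t : ℝ, 0 < h → 0 < L → 0 < σ → 0 ≤ t → ∀ K ∈ CoarseNLS.lattice L,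
        CoarseNLS.coarse (CoarseNLS.firstOrder (CoarseNLS.initialDatum η h L) t) K σ =
          (1 / (2 * (Real.pi : ℂ)) ^ 4) * CoarseNLS.interactionSum η L K t + r h L σ K t) ∧
      (∃ C : ℝ, 0 < C ∧ ∀ δ : ℝ, 0 < δ → ∃ C' : ℝ, 0 < C' ∧
        ∀ (ι : Type*) (l : Filter ι) (h L σ : ι → ℝ), CoarseNLS.AsymptoticRegime l h L σ →
          ∀ᶠ i in l, ∀ K ∈ CoarseNLS.lattice (L i), ∀ t : ℝ,
            0 ≤ t → t ≤ 1 / (σ i ^ 2 * L i ^ 2) →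
            ‖r (h i) (L i) (σ i) K t‖ ≤
              C * L i ^ 6 *
                  Real.exp (-(1 / (2 * σ i ^ 2 * L i ^ 2)) + C * (t + h i ^ 2 / σ i ^ 4))
                + C * t * L i ^ 2 * Real.log (L i) *
                  (h i ^ 2 / σ i ^ 2 + t * σ i ^ 2 + t ^ 2 * h i ^ 2 + t ^ 3 * σ i ^ 4)
                + C' * L i ^ (4 + δ) *
                  (h i ^ 2 / σ i ^ 2 + t * σ i ^ 2 + t ^ 2 * σ i ^ 2 + t ^ 3 * σ i ^ 4)) ∧
      (∀ (ι : Type*) (l : Filter ι) (h L σ t : ι → ℝ) (K : ι → CoarseNLS.Plane),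
        CoarseNLS.AsymptoticRegime l h L σ →
        (∀ᶠ i in l, K i ∈ CoarseNLS.lattice (L i)) →
        (∀ᶠ i in l, 0 ≤ t i) →
        (t =o[l] fun i => 1 / h i) →
        (fun i => r (h i) (L i) (σ i) (K i) (t i)) =o[l]
          fun i => t i * L i ^ 2 * Real.log (L i) + L i ^ 4) := by
  obtain ⟨M, hM⟩ := hη.exists_norm_le
  obtain ⟨R, hR⟩ := hsupp.exists_norm_le
  obtain ⟨C, hC, hbound⟩ := CoarseNLS.exists_remainderBound
    (fun K => hM _ (Set.mem_range_self K)) (le_max_right R 1)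
    (fun K hK => (hR K hK).trans (le_max_left R 1))
  refine ⟨CoarseNLS.remainder η, fun h L σ t _ _ _ _ K _ => ?_,
    ⟨C, hC, fun δ hδ => ⟨C * (2 / δ) ^ 2, by positivity, fun ι l h L σ H => ?_⟩⟩,
    fun ι l h L σ t K H hK ht hth => ?_⟩
  · rw [CoarseNLS.remainder, add_sub_cancel]
  · exact hbound.eventually_le hC hδ H
  · exact hbound.isLittleO hC H hK ht hth

theorem proposition4p3 (η : CoarseNLS.Plane → ℂ) (hη : ContDiff ℝ (⊤ : ℕ∞) η)
    (hsupp : HasCompactSupport η) :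
    ∃ r : (h L σ : ℝ) → (K : CoarseNLS.Plane) → (t : ℝ) → ℂ,
      -- the expansion, which defines the remainder
      (∀ h L σ t : ℝ, 0 < h → 0 < L → 0 < σ → 0 ≤ t → ∀ K ∈ CoarseNLS.lattice L,
        CoarseNLS.coarse (CoarseNLS.firstOrder (CoarseNLS.initialDatum η h L) t) K σ =
          (1 / (2 * (Real.pi : ℂ)) ^ 4) * CoarseNLS.interactionSum η L K t + r h L σ K t) ∧
      -- the explicit bound
      (∃ C : ℝ, 0 < C ∧ ∀ δ : ℝ, 0 < δ → ∃ C' : ℝ, 0 < C' ∧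
        ∀ (ι : Type*) (l : Filter ι) (h L σ : ι → ℝ), CoarseNLS.AsymptoticRegime l h L σ →
          ∀ᶠ i in l, ∀ K ∈ CoarseNLS.lattice (L i), ∀ t : ℝ,
            0 ≤ t → t ≤ 1 / (σ i ^ 2 * L i ^ 2) →
            ‖r (h i) (L i) (σ i) K t‖ ≤
              C * L i ^ 6 *
                  Real.exp (-(1 / (2 * σ i ^ 2 * L i ^ 2)) + C * (t + h i ^ 2 / σ i ^ 4))
                + C * t * L i ^ 2 * Real.log (L i) *
                  (h i ^ 2 / σ i ^ 2 + t * σ i ^ 2 + t ^ 2 * h i ^ 2 + t ^ 3 * σ i ^ 4)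
                + C' * L i ^ (4 + δ) *
                  (h i ^ 2 / σ i ^ 2 + t * σ i ^ 2 + t ^ 2 * σ i ^ 2 + t ^ 3 * σ i ^ 4)) ∧
      -- the smallness of the remainder for `t ≪ 1 / h`
      (∀ (ι : Type*) (l : Filter ι) (h L σ t : ι → ℝ) (K : ι → CoarseNLS.Plane),
        CoarseNLS.AsymptoticRegime l h L σ →
        (∀ᶠ i in l, K i ∈ CoarseNLS.lattice (L i)) →
        (∀ᶠ i in l, 0 ≤ t i) →
        (t =o[l] fun i => 1 / h i) →
        (fun i => r (h i) (L i) (σ i) (K i) (t i)) =o[l]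
          fun i => t i * L i ^ 2 * Real.log (L i) + L i ^ 4) :=
  proposition4p3_general η (hsupp.isCompact_range hη.continuous).isBounded
    (hsupp.isCompact.isBounded.subset (subset_tsupport η))
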